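/- Let $q\in(0,1)$, $c\in\mathbb R$, and let $d\ge 1$ be an integer. Let $\underline\mu^c$ be the product measure on $\{0,1\}^{\mathbb Z}$ whose marginal at site $i$ gives mass $q^{-(i-c)z}/(1+q^{-(i-c)})$ to $z\in\{0,1\}$. Consider the following coupled system. The first component $\underline\xi(t)$ is the asymmetric simple exclusion process on the set of configurations in $\{0,1\}^{\mathbb Z}$ with finitely many particles at sites $i\le 0$ and finitely many empty sites $i>0$: each particle jumps to the neighbouring site on its right at rate $1$ and on its left at rate $q$, provided the target site is empty. The label of a particle of $\underline\xi$ is the number of particles of $\underline\xi$ strictly to its left. The second component $\underline\gamma(t)$ takes values in the configurations in $\{0,1\}^{\mathbb Z_{\ge 0}}$ with exactly $d$ particles; each of these particles jumps to the neighbouring site on its right at rate $q$ and on its left at rate $1$, provided the target site is an empty site of $\mathbb Z_{\geq 0}$, and a jump over the edge $(i,i+1)$ is possible only while the particles of $\underline\xi$ with labels $i$ and $i+1$ occupy neighbouring sites. Let $\underline\eta(t)$ be obtained from $\underline\xi(t)$ by removing the $d$ particles whose labels are the occupied sites of $\underline\gamma(t)$; the removed particles are called second-class particles. (Equivalently, $(\underline\eta,\underline\xi)$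 is the basic coupling of two asymmetric simple exclusion processes with $\eta_i\le\xi_i$ for all $i$ and exactly $d$ discrepancies.) Assume that the coupled system $(\underline\xi(t),\underline\gamma(t))_{t\ge 0}$ is stationary and that $\underline\xi\sim\underline\mu^c$. Then for every $m\in\mathbb Z$, at any time, there is a second-class particle at site $m$ with probability $$\mathbb P(\xi_m>\eta_m)=\frac{(1-q^d)\,q^{c-m}}{(1+q^{c-m})(1+q^{c+d-m})}.$$ -/

import Mathlib

open MeasureTheory Filter Topology
open scoped NNReal ENNReal

namespace ASEP

/-- Exchange of the occupation variables at the ends of the edge `(i, i + 1)`. When exactly one of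
the two sites is occupied, this is the state reached by the particle jumping over that edge. -/
def exchange {ι : Type*} [DecidableEq ι] [Add ι] [One ι] (z : ι → Bool) (i : ι) : ι → Bool :=
  z ∘ Equiv.swap i (i + 1)

/-- A configuration of particles on `ℤ` (`true` = occupied) with finitely many particles at or to
the left of the origin and finitely many holes to the right of it. -/
def IsBlocking (z : ℤ → Bool) : Prop :=
  {i : ℤ | i ≤ 0 ∧ z i = true}.Finite ∧ {i : ℤ | 0 < i ∧ z i = false}.Finite

theorem IsBlocking.exchange {z : ℤ → Bool} (hz : IsBlocking z) (i : ℤ) :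
    IsBlocking (exchange z i) := by
  have key : ∀ k : ℤ, k ≠ i → k ≠ i + 1 → ASEP.exchange z i k = z k := fun k h1 h2 => by
    simp [ASEP.exchange, Equiv.swap_apply_of_ne_of_ne h1 h2]
  have hfin : ({i, i + 1} : Set ℤ).Finite := Set.toFinite _
  refine ⟨(hz.1.union hfin).subset ?_, (hz.2.union hfin).subset ?_⟩ <;>
  · rintro k ⟨hk, hzk⟩
    by_cases h1 : k = i
    · exact Or.inr (Or.inl h1)
    by_cases h2 : k = i + 1
    · exact Or.inr (Or.inr h2)
    · exact Or.inl ⟨hk, by rw [← key k h1 h2]; exact hzk⟩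

theorem encard_exchange (g : ℕ → Bool) (i : ℕ) :
    {k : ℕ | exchange g i k = true}.encard = {k : ℕ | g k = true}.encard := by
  have : {k : ℕ | exchange g i k = true} = (Equiv.swap i (i + 1)) '' {k : ℕ | g k = true} := by
    rw [Equiv.image_eq_preimage_symm]
    rfl
  rw [this, (Equiv.swap i (i + 1)).injective.encard_image]

/-- The state space of the exclusion process on `ℤ`. -/
abbrev BlockingState : Type := {z : ℤ → Bool // IsBlocking z}

/-- The state space of the label process: configurations on `ℤ_{≥0}` with exactly `d` particles. -/
abbrev LabelState (d : ℕ) : Type := {g : ℕ → Bool // {k : ℕ | g k = true}.encard = d}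

/-- The state space of the coupled system: a configuration `ξ` on `ℤ` together with a
configuration `γ` of `d` labels. It carries the (countably generated) product σ-algebra. -/
abbrev CoupledState (d : ℕ) : Type := BlockingState × LabelState d

/-- The state after the particle jump over the edge `(i, i + 1)` of `ℤ`. -/
def BlockingState.jump (x : BlockingState) (i : ℤ) : BlockingState :=
  ⟨exchange x.1 i, x.2.exchange i⟩

/-- The state after the particle jump over the edge `(i, i + 1)` of `ℤ_{≥0}`. -/
def LabelState.jump {d : ℕ} (g : LabelState d) (i : ℕ) : LabelState d :=
  ⟨exchange g.1 i, (encard_exchange g.1 i).trans g.2⟩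

/-- Nearest-neighbour exclusion rate over an edge whose left and right ends have occupations `a`
and `b`: a particle jumps right at rate `r` and left at rate `l`, if its target is empty. -/
def edgeRate (r l : ℝ) (a b : Bool) : ℝ :=
  (if a = true ∧ b = false then r else 0) + (if b = true ∧ a = false then l else 0)

/-- The label of a particle at site `j`: the number of particles strictly to its left. -/
noncomputable def label (z : ℤ → Bool) (j : ℤ) : ℕ := {k : ℤ | k < j ∧ z k = true}.ncard

/-- The particles of `z` with labels `i` and `i + 1` occupy neighbouring sites. -/
def LabelsAdjacent (z : ℤ → Bool) (i : ℕ) : Prop :=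
  ∃ j : ℤ, label z j = i ∧ z j = true ∧ z (j + 1) = true

open Classical in
/-- The generator of the coupled system. The particles of `ξ` perform the asymmetric simple
exclusion process on `ℤ` (rate `1` to the right, `q` to the left); the labels `γ` perform an
exclusion process on `ℤ_{≥0}` (rate `q` to the right, `1` to the left) in which a jump over
`(i, i + 1)` is allowed only while the particles of `ξ` labelled `i` and `i + 1` are neighbours.
In every state only finitely many terms of the two sums are nonzero. -/
noncomputable def generator (q : ℝ) {d : ℕ} (f : CoupledState d → ℝ) (x : CoupledState d) : ℝ :=
  (∑' i : ℤ, edgeRate 1 q (x.1.1 i) (x.1.1 (i + 1)) * (f (x.1.jump i, x.2) - f x)) +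
  ∑' i : ℕ, (if LabelsAdjacent x.1.1 i then edgeRate q 1 (x.2.1 i) (x.2.1 (i + 1)) else 0) *
    (f (x.1, x.2.jump i) - f x)

/-- The configuration `ξ` of all the particles of the coupled system. -/
def CoupledState.xi {d : ℕ} (x : CoupledState d) : ℤ → Bool := x.1.1

/-- The configuration `η`, obtained from `ξ` by removing the particles whose labels are occupied
in `γ`; the removed particles are the second-class particles. -/
noncomputable def CoupledState.eta {d : ℕ} (x : CoupledState d) : ℤ → Bool :=
  fun j => x.1.1 j && !(x.2.1 (label x.1.1 j))

/-- `Z` is a version of the coupled system, with respect to the filtration `𝓕`: a pure jump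
process (piecewise constant, right-continuous, with left limits for the discrete topology of the
countable state space) which solves the martingale problem for the generator. -/
structure IsCoupledProcess (q : ℝ) (d : ℕ) {Ω : Type*} {mΩ : MeasurableSpace Ω} (P : Measure Ω)
    (𝓕 : Filtration ℝ≥0 mΩ) (Z : ℝ≥0 → Ω → CoupledState d) : Prop where
  adapted : ∀ t, Measurable[𝓕 t] (Z t)
  right_continuous : ∀ ω t, ∀ᶠ s in 𝓝[≥] t, Z s ω = Z t ω
  left_limits : ∀ ω t, 0 < t → ∃ x, ∀ᶠ s in 𝓝[<] t, Z s ω = x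
  martingale : ∀ f : CoupledState d → ℝ, (Function.support f).Finite →
    Martingale (fun (t : ℝ≥0) ω => f (Z t ω) - f (Z 0 ω) -
      ∫ s in (0 : ℝ)..t, generator q f (Z s.toNNReal ω)) 𝓕 P

/-- The one-site marginal: mass `q^{-(i-c)z} / (1 + q^{-(i-c)})` at `z ∈ {0, 1}`. -/
noncomputable def blockingMarginal (q c : ℝ) (i : ℤ) : Measure Bool :=
  ENNReal.ofReal (q ^ (-((i : ℝ) - c)) / (1 + q ^ (-((i : ℝ) - c)))) • Measure.dirac true +
  ENNReal.ofReal (1 / (1 + q ^ (-((i : ℝ) - c)))) • Measure.dirac false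

theorem isProbabilityMeasure_blockingMarginal {q : ℝ} (hq : 0 < q) (c : ℝ) (i : ℤ) :
    IsProbabilityMeasure (blockingMarginal q c i) := by
  have h : 0 < q ^ (-((i : ℝ) - c)) := Real.rpow_pos_of_pos hq _
  constructor
  simp only [blockingMarginal, Measure.add_apply, Measure.smul_apply, measure_univ, smul_eq_mul,
    mul_one]
  rw [← ENNReal.ofReal_add (by positivity) (by positivity), ← ENNReal.ofReal_one]
  congr 1
  field_simp
  ring

/-- The product blocking measure `μ^c` with asymmetry parameter `q`. -/
noncomputable def blockingMeasure (q c : ℝ) : Measure (ℤ → Bool) :=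
  Measure.infinitePi (blockingMarginal q c)

end ASEP

/-! Only the ξ-marginal of the stationary law ν is given, so the main point is to identify the
conditional law of the labels given ξ. Let w be the product of the blocking measure with the weight
q^(sum of occupied labels). Both factors satisfy detailed balance, and the adjacency constraint on
label jumps depends on ξ alone, so w is reversible. Global balance for ν, divided through by
reversibility, says that h = ν/w is harmonic for the symmetric conductances w · rate. These
conductances have finite total mass, which forces a nonnegative harmonic function to agree at the
two ends of every edge of nonzero conductance (`eq_of_harmonic`). Any two label configurations over
the same ξ of positive mass are joined by such edges: bring the particles with labels i and i + 1
together, exchange their classes, and move the particle back (`eq_of_constant_along_edges`). Hence,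
given ξ, a set of d labels has probability proportional to q^(its sum)
(`IsCoupledProcess.exists_law_eq`).

Under this law label k is occupied with probability ρ_d(q^k), where ρ_d is the polynomial
`labelDensity`; deleting k from the set gives ρ_(d+1)(y) = const · y(1 − ρ_d(y)). The probability
sought is therefore E[1{ξ_m = 1} ρ_d(q^N)], with N the number of particles to the left of m. With x
= q^(c−m), independence and a telescoping product give E[1{ξ_m = 1} q^(jN)] = x ∏_{l ≤ j} (1 + x
q^l)⁻¹ (`integral_label_moment`). Induction on d through the recursion for ρ_d then yields the
closed form (`integral_labelDensity`). -/

namespace ASEP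

/-! ### Nonnegative harmonic functions for summable symmetric conductances -/

/-- If the conductances `c` are symmetric and summable, a nonnegative function which is harmonic
for them is constant along every edge of nonzero conductance. -/
theorem eq_of_harmonic {X E : Type*} {c : X → E → ℝ} {J : E → X → X}
    (hJ : ∀ e x, J e (J e x) = x) (hc : ∀ x e, 0 ≤ c x e) (hsymm : ∀ x e, c (J e x) e = c x e)
    (hsum : Summable fun p : X × E => c p.1 p.2) (hfin : ∀ x, {e | c x e ≠ 0}.Finite)
    {h : X → ℝ} (hh : ∀ x, 0 ≤ h x) (hharm : ∀ x, ∑' e, c x e * (h (J e x) - h x) = 0)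
    {x : X} {e : E} (hce : c x e ≠ 0) : h (J e x) = h x := by
  -- The function h may be unbounded, so it is replaced by φ(h) with φ bounded and strictly concave.
  -- Boundedness makes the edge sums absolutely convergent; strict concavity leaves a definite sign.
  set φ : ℝ → ℝ := fun a => a / (1 + a) with hφ
  have hφ0 : ∀ a, 0 ≤ a → 0 ≤ φ a := fun a ha => by positivity
  have hφ1 : ∀ a, 0 ≤ a → φ a ≤ 1 := fun a ha => by
    rw [hφ]; exact (div_le_one (by positivity)).2 (by linarith)
  set T : X × E → ℝ := fun p => c p.1 p.2 * (φ (h (J p.2 p.1)) - φ (h p.1)) with hT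
  have hTs : Summable T := by
    refine Summable.of_norm_bounded hsum fun p => ?_
    rw [hT, norm_mul, Real.norm_of_nonneg (hc _ _)]
    refine mul_le_of_le_one_right (hc _ _) ?_
    rw [Real.norm_eq_abs, abs_le]
    have h1 := hφ0 _ (hh (J p.2 p.1))
    have h2 := hφ0 _ (hh p.1)
    have h3 := hφ1 _ (hh (J p.2 p.1))
    have h4 := hφ1 _ (hh p.1)
    constructor <;> linarith
  -- Reversing each edge preserves the conductance and changes the sign of the increment, so the
  -- total equals its own negative.
  have hT0 : ∑' p, T p = 0 := by
    let σ : X × E ≃ X × E :=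
      ⟨fun p => (J p.2 p.1, p.2), fun p => (J p.2 p.1, p.2), fun p => by simp [hJ],
        fun p => by simp [hJ]⟩
    have h1 : ∑' p, T (σ p) = ∑' p, T p := σ.tsum_eq T
    have h2 : ∀ p, T (σ p) = -T p := fun p => by
      simp only [hT, σ, Equiv.coe_fn_mk, hJ, hsymm]; ring
    simp only [h2, tsum_neg] at h1
    linarith
  set Q : X → E → ℝ := fun x e =>
    c x e * ((h (J e x) - h x) ^ 2 / ((1 + h x) ^ 2 * (1 + h (J e x)))) with hQ
  have hQ0 : ∀ x e, 0 ≤ Q x e := fun x e => by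
    have := hc x e
    have := hh x
    have := hh (J e x)
    positivity
  have hfs : ∀ (x : X) (u : E → ℝ), Summable fun e => c x e * u e := fun x u =>
    summable_of_hasFiniteSupport ((hfin x).subset fun e he h0 => he (by simp [h0]))
  have hTQ : ∀ x, ∑' e, T (x, e) = -∑' e, Q x e := fun x => by
    -- Tangent line of φ at h x, with slope 1 / (1 + h x)², minus the exact concavity defect Q.
    -- Harmonicity kills the linear term, so the nonnegative defects sum to zero and each of them
    -- vanishes.
    have h1 : ∀ e, T (x, e) = c x e * (h (J e x) - h x) * (1 / (1 + h x) ^ 2) - Q x e := fun e => by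
      have := hh x
      have := hh (J e x)
      simp only [hT, hQ, hφ]
      field_simp
      ring
    simp_rw [h1]
    rw [((hfs x _).mul_right _).tsum_sub (hfs x _), tsum_mul_right, hharm x]
    ring
  have hS : HasSum (fun x => ∑' e, Q x e) 0 := by
    have h1 := hTs.hasSum.prod_fiberwise fun x => (hTs.prod_factor x).hasSum
    rw [hT0] at h1
    simp_rw [hTQ] at h1
    simpa using h1.neg
  have h0 := (hasSum_zero_iff_of_nonneg fun x => tsum_nonneg (hQ0 x)).1 hS
  have h1 : ∑' e, Q x e = 0 := congrFun h0 x
  have h2 : HasSum (Q x) 0 := h1 ▸ (hfs x _).hasSum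
  have h3 : Q x e = 0 := congrFun ((hasSum_zero_iff_of_nonneg (hQ0 x)).1 h2) e
  have := hh x
  have := hh (J e x)
  have h4 : (1 + h x) ^ 2 * (1 + h (J e x)) ≠ 0 := by positivity
  simp only [hQ, mul_eq_zero, hce, div_eq_zero_iff, h4, or_false, false_or] at h3
  exact sub_eq_zero.1 (pow_eq_zero_iff two_ne_zero |>.1 h3)

/-! ### Generating functions of finite sets of labels -/

/-- The weight `q ^ ∑ S` of a finite set of labels. -/
noncomputable def labelWeight (q : ℝ) (S : Finset ℕ) : ℝ := ∏ k ∈ S, q ^ k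

theorem labelWeight_pos {q : ℝ} (hq : 0 < q) (S : Finset ℕ) : 0 < labelWeight q S :=
  Finset.prod_pos fun _ _ => pow_pos hq _

theorem summable_labelWeight {q : ℝ} (hq0 : 0 < q) (hq1 : q < 1) : Summable (labelWeight q) :=
  summable_finsetProd_of_summable_nonneg (fun _ => by positivity)
    (summable_geometric_of_lt_one hq0.le hq1)

/-- Total weight of the `d`-element sets of labels. -/
noncomputable def labelSum (q : ℝ) (d : ℕ) : ℝ :=
  ∑' S : Finset ℕ, if S.card = d then labelWeight q S else 0

/-- Total weight of the `d`-element sets of labels containing `k`. -/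
noncomputable def labelSumMem (q : ℝ) (d k : ℕ) : ℝ :=
  ∑' S : Finset ℕ, if S.card = d ∧ k ∈ S then labelWeight q S else 0

/-- The density of the label `k`, as a function of `y = q ^ k`, when `d`-element sets are weighted
by `labelWeight`. -/
noncomputable def labelDensity (q : ℝ) : ℕ → ℝ → ℝ
  | 0, _ => 0
  | d + 1, y => (1 - q ^ (d + 1)) / q ^ d * (y * (1 - labelDensity q d y))

theorem summable_ite_labelWeight {q : ℝ} (hq0 : 0 < q) (hq1 : q < 1) (p : Finset ℕ → Prop)
    [DecidablePred p] : Summable fun S => if p S then labelWeight q S else 0 := by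
  refine (summable_labelWeight hq0 hq1).of_nonneg_of_le (fun S => ?_) fun S => ?_
  · split_ifs
    exacts [(labelWeight_pos hq0 S).le, le_rfl]
  · split_ifs
    exacts [le_rfl, (labelWeight_pos hq0 S).le]

theorem labelSumMem_zero (q : ℝ) (k : ℕ) : labelSumMem q 0 k = 0 := by
  have h : ∀ S : Finset ℕ, ¬(S.card = 0 ∧ k ∈ S) := by
    rintro S ⟨h, hk⟩
    simp_all
  simp only [labelSumMem, if_neg (h _), tsum_zero]

theorem labelSum_sub_labelSumMem {q : ℝ} (hq0 : 0 < q) (hq1 : q < 1) (d k : ℕ) :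
    labelSum q d - labelSumMem q d k =
      ∑' S : Finset ℕ, if S.card = d ∧ k ∉ S then labelWeight q S else 0 := by
  rw [labelSum, labelSumMem, ← (summable_ite_labelWeight hq0 hq1 _).tsum_sub
    (summable_ite_labelWeight hq0 hq1 _)]
  refine tsum_congr fun S => ?_
  by_cases h1 : S.card = d <;> by_cases h2 : k ∈ S <;> simp [h1, h2]

/-- Toggling the membership of k is an involution on finite sets; it pairs the (d + 1)-sets
containing k with the d-sets avoiding k, at the cost of a factor q^k. -/
theorem labelSumMem_succ {q : ℝ} (hq0 : 0 < q) (hq1 : q < 1) (d k : ℕ) :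
    labelSumMem q (d + 1) k = q ^ k * (labelSum q d - labelSumMem q d k) := by
  rw [labelSum_sub_labelSumMem hq0 hq1, ← tsum_mul_left]
  have hinv : Function.Involutive fun S : Finset ℕ => if k ∈ S then S.erase k else insert k S := by
    intro S
    by_cases h : k ∈ S <;> simp [h]
  rw [labelSumMem, ← hinv.toPerm.tsum_eq]
  refine tsum_congr fun S => ?_
  by_cases h : k ∈ S <;> simp [h, labelWeight]

/-- The sets avoiding 0 are the translates by one of arbitrary sets, and translation multiplies the
weight of a d-set by q^d. -/
theorem labelSum_sub_labelSumMem_zero {q : ℝ} (hq0 : 0 < q) (hq1 : q < 1) (d : ℕ) :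
    labelSum q d - labelSumMem q d 0 = q ^ d * labelSum q d := by
  rw [labelSum_sub_labelSumMem hq0 hq1, labelSum, ← tsum_mul_left]
  have hinj : Function.Injective (Finset.map (addRightEmbedding (1 : ℕ))) :=
    Finset.map_injective _
  rw [← hinj.tsum_eq]
  · refine tsum_congr fun S => ?_
    by_cases h : S.card = d
    · simp [h, labelWeight, pow_succ, Finset.prod_mul_distrib, mul_comm]
    · simp [h]
  · intro S hS
    have h0 : 0 ∉ S := fun h0 => hS (if_neg fun h => h.2 h0)
    refine ⟨S.image (· - 1), ?_⟩
    ext k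
    simp only [Finset.mem_map, Finset.mem_image, addRightEmbedding_apply]
    constructor
    · rintro ⟨_, ⟨a, ha, rfl⟩, rfl⟩
      have : a ≠ 0 := fun h => h0 (h ▸ ha)
      rwa [Nat.sub_add_cancel (by omega)]
    · intro hk
      have : k ≠ 0 := fun h => h0 (h ▸ hk)
      exact ⟨k - 1, ⟨k, hk, rfl⟩, by omega⟩

/-- Both sides are the weight of the (d + 1)-sets containing 0, evaluated once by complement and
once by deleting 0. -/
theorem labelSum_succ {q : ℝ} (hq0 : 0 < q) (hq1 : q < 1) (d : ℕ) :
    (1 - q ^ (d + 1)) * labelSum q (d + 1) = q ^ d * labelSum q d := by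
  have h1 := labelSum_sub_labelSumMem_zero hq0 hq1 (d + 1)
  have h2 := labelSumMem_succ hq0 hq1 d 0
  rw [labelSum_sub_labelSumMem_zero hq0 hq1] at h2
  linarith

theorem labelSumMem_eq {q : ℝ} (hq0 : 0 < q) (hq1 : q < 1) (d k : ℕ) :
    labelSumMem q d k = labelSum q d * labelDensity q d (q ^ k) := by
  induction d with
  | zero => simp [labelSumMem_zero, labelDensity]
  | succ d ih =>
    rw [labelSumMem_succ hq0 hq1, ih, labelDensity]
    have h := labelSum_succ hq0 hq1 d
    have hq : q ^ d ≠ 0 := by positivity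
    field_simp
    linear_combination (-(1 - labelDensity q d (q ^ k))) * h

/-! ### Moments of the label of a site -/

theorem measurable_labelDensity (q : ℝ) (d : ℕ) : Measurable (labelDensity q d) := by
  induction d with
  | zero => exact measurable_const
  | succ d ih => simp only [labelDensity]; fun_prop

theorem exists_labelDensity_bound (q : ℝ) (d : ℕ) :
    ∃ C, ∀ y, 0 ≤ y → y ≤ 1 → |labelDensity q d y| ≤ C := by
  induction d with
  | zero => exact ⟨0, fun y _ _ => by simp [labelDensity]⟩
  | succ d ih =>
    obtain ⟨C, hC⟩ := ih
    refine ⟨|(1 - q ^ (d + 1)) / q ^ d| * (1 * (1 + C)), fun y h0 h1 => ?_⟩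
    rw [labelDensity, abs_mul, abs_mul]
    gcongr
    · rwa [abs_of_nonneg h0]
    · exact (abs_sub _ _).trans (by simpa using hC y h0 h1)

theorem integrable_mul_labelDensity {Ω : Type*} {mΩ : MeasurableSpace Ω} {P : Measure Ω}
    [IsFiniteMeasure P] {X Y : Ω → ℝ} (hX : Measurable X) (hY : Measurable Y)
    (hX1 : ∀ ω, |X ω| ≤ 1) (hY0 : ∀ ω, 0 ≤ Y ω) (hY1 : ∀ ω, Y ω ≤ 1) (q : ℝ) (d j : ℕ) :
    Integrable (fun ω => X ω * Y ω ^ j * labelDensity q d (Y ω)) P := by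
  obtain ⟨C, hC⟩ := exists_labelDensity_bound q d
  refine Integrable.of_bound (C := 1 * 1 ^ j * C) ?_ (ae_of_all _ fun ω => ?_)
  · exact ((hX.mul (hY.pow_const j)).mul
      ((measurable_labelDensity q d).comp hY)).aestronglyMeasurable
  · rw [norm_mul, norm_mul, norm_pow, Real.norm_eq_abs, Real.norm_eq_abs, Real.norm_eq_abs]
    have := hY0 ω
    gcongr
    · exact hX1 ω
    · rw [abs_of_nonneg this]; exact hY1 ω
    · exact hC _ this (hY1 ω)

/-- The recursion for `labelDensity` raises the power of Y by one while lowering d, so the induction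
must carry all j at once, although only j = 0 is needed in the end. -/
theorem integral_labelDensity {Ω : Type*} {mΩ : MeasurableSpace Ω} {P : Measure Ω}
    [IsFiniteMeasure P] {X Y : Ω → ℝ} (hX : Measurable X) (hY : Measurable Y)
    (hX1 : ∀ ω, |X ω| ≤ 1) (hY0 : ∀ ω, 0 ≤ Y ω) (hY1 : ∀ ω, Y ω ≤ 1)
    {q x : ℝ} (hq : 0 < q) (hx : 0 < x)
    (hmom : ∀ j : ℕ, ∫ ω, X ω * Y ω ^ j ∂P = x * ∏ l ∈ Finset.range (j + 1), (1 + x * q ^ l)⁻¹)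
    (d j : ℕ) :
    ∫ ω, X ω * Y ω ^ j * labelDensity q d (Y ω) ∂P =
      (1 - q ^ d) * (x * ∏ l ∈ Finset.range (j + 1), (1 + x * q ^ l)⁻¹) / (1 + x * q ^ (j + d)) := by
  induction d generalizing j with
  | zero => simp [labelDensity]
  | succ d ih =>
    have hi : Integrable (fun ω => X ω * Y ω ^ (j + 1)) P := by
      refine Integrable.of_bound (C := 1 * 1 ^ (j + 1))
        (hX.mul (hY.pow_const _)).aestronglyMeasurable (ae_of_all _ fun ω => ?_)
      rw [norm_mul, norm_pow, Real.norm_eq_abs, Real.norm_eq_abs]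
      gcongr
      · exact hX1 ω
      · rw [abs_of_nonneg (hY0 ω)]; exact hY1 ω
    have h1 : ∀ ω, X ω * Y ω ^ j * labelDensity q (d + 1) (Y ω) =
        (1 - q ^ (d + 1)) / q ^ d *
          (X ω * Y ω ^ (j + 1) - X ω * Y ω ^ (j + 1) * labelDensity q d (Y ω)) := fun ω => by
      rw [labelDensity]; ring
    simp_rw [h1]
    rw [integral_const_mul,
      integral_sub hi (integrable_mul_labelDensity hX hY hX1 hY0 hY1 q d (j + 1)), ih, hmom,
      Finset.prod_range_succ _ (j + 1)]
    have h2 : 1 + x * q ^ (j + 1) ≠ 0 := by positivity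
    have h3 : 1 + x * q ^ (j + 1 + d) ≠ 0 := by positivity
    have h4 : 1 + x * q ^ (j + (d + 1)) ≠ 0 := by positivity
    generalize ∏ l ∈ Finset.range (j + 1), (1 + x * q ^ l)⁻¹ = D
    field_simp
    ring

end ASEP

namespace ASEP

/-! ### The blocking measure -/

theorem blockingMarginal_real_true {q : ℝ} (hq : 0 < q) (c : ℝ) (i : ℤ) :
    (blockingMarginal q c i).real {true} = q ^ (c - i) / (1 + q ^ (c - i)) := by
  have h : 0 < q ^ (c - i) := Real.rpow_pos_of_pos hq _
  simp [blockingMarginal, Measure.real, neg_sub]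
  positivity

theorem blockingMarginal_real_false {q : ℝ} (hq : 0 < q) (c : ℝ) (i : ℤ) :
    (blockingMarginal q c i).real {false} = 1 / (1 + q ^ (c - i)) := by
  have h : 0 < q ^ (c - i) := Real.rpow_pos_of_pos hq _
  simp [blockingMarginal, Measure.real, neg_sub]
  positivity

theorem isProbabilityMeasure_blockingMeasure {q : ℝ} (hq : 0 < q) (c : ℝ) :
    IsProbabilityMeasure (blockingMeasure q c) := by
  have := isProbabilityMeasure_blockingMarginal hq c
  unfold blockingMeasure
  infer_instance

/-! ### Exchanges and detailed balance for the blocking measure. -/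

theorem exchange_left {ι : Type*} [DecidableEq ι] [Add ι] [One ι] (z : ι → Bool) (i : ι) :
    exchange z i i = z (i + 1) := by simp [exchange]

theorem exchange_right {ι : Type*} [DecidableEq ι] [Add ι] [One ι] (z : ι → Bool) (i : ι) :
    exchange z i (i + 1) = z i := by simp [exchange]

theorem exchange_of_ne {ι : Type*} [DecidableEq ι] [Add ι] [One ι] (z : ι → Bool) {i k : ι}
    (h1 : k ≠ i) (h2 : k ≠ i + 1) : exchange z i k = z k := by
  simp [exchange, Equiv.swap_apply_of_ne_of_ne h1 h2]

theorem exchange_exchange {ι : Type*} [DecidableEq ι] [Add ι] [One ι] (z : ι → Bool) (i : ι) :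
    exchange (exchange z i) i = z := by
  funext k
  simp [exchange]

theorem exchange_eq_self {ι : Type*} [DecidableEq ι] [Add ι] [One ι] {z : ι → Bool} {i : ι}
    (h : z i = z (i + 1)) : exchange z i = z := by
  funext k
  by_cases h1 : k = i
  · rw [h1, exchange_left, h]
  by_cases h2 : k = i + 1
  · rw [h2, exchange_right, h]
  exact exchange_of_ne z h1 h2

theorem tendsto_prod_blockingMarginal {q : ℝ} (hq : 0 < q) (c : ℝ) (z : ℤ → Bool) :
    Tendsto (fun s : Finset ℤ => ∏ i ∈ s, (blockingMarginal q c i).real {z i}) atTop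
      (𝓝 ((blockingMeasure q c).real {z})) := by
  have := isProbabilityMeasure_blockingMarginal hq c
  have := isProbabilityMeasure_blockingMeasure hq c
  have h1 : HasProd (fun i => blockingMarginal q c i {z i}) (blockingMeasure q c {z}) := by
    rw [blockingMeasure, Measure.infinitePi_singleton]
    exact (ENNReal.multipliable_of_le_one fun i => prob_le_one).hasProd
  have h2 := (ENNReal.tendsto_toReal (measure_ne_top (blockingMeasure q c) {z})).comp h1
  refine h2.congr fun s => ?_
  simp [Measure.real, ENNReal.toReal_prod]

/-- Point masses are limits of finite products. Once the window contains i and i + 1, the products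
for the two configurations differ only in those two factors, whose ratio is q. -/
theorem blockingMeasure_detailed_balance {q : ℝ} (hq : 0 < q) (c : ℝ) (z : ℤ → Bool) (i : ℤ)
    (h1 : z i = true) (h2 : z (i + 1) = false) :
    (blockingMeasure q c).real {z} = q * (blockingMeasure q c).real {exchange z i} := by
  refine tendsto_nhds_unique (tendsto_prod_blockingMarginal hq c z)
    (((tendsto_prod_blockingMarginal hq c (exchange z i)).const_mul q).congr' ?_)
  filter_upwards [eventually_ge_atTop {i, i + 1}] with s hs
  have hne : i ≠ i + 1 := by omega
  rw [← Finset.prod_sdiff hs, ← Finset.prod_sdiff hs, Finset.prod_pair hne, Finset.prod_pair hne,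
    exchange_left, exchange_right, h1, h2, blockingMarginal_real_true hq,
    blockingMarginal_real_true hq, blockingMarginal_real_false hq, blockingMarginal_real_false hq]
  have h3 : ∏ k ∈ s \ {i, i + 1}, (blockingMarginal q c k).real {exchange z i k} =
      ∏ k ∈ s \ {i, i + 1}, (blockingMarginal q c k).real {z k} := by
    refine Finset.prod_congr rfl fun k hk => ?_
    simp only [Finset.mem_sdiff, Finset.mem_insert, Finset.mem_singleton, not_or] at hk
    rw [exchange_of_ne z hk.2.1 hk.2.2]
  have h4 : q ^ (c - i) = q * q ^ (c - ((i + 1 : ℤ) : ℝ)) := by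
    nth_rw 2 [← Real.rpow_one q]
    rw [← Real.rpow_add hq]
    congr 1
    push_cast
    ring
  have h5 : 0 < q ^ (c - ((i + 1 : ℤ) : ℝ)) := Real.rpow_pos_of_pos hq _
  rw [h3, h4]
  field_simp

theorem blockingMeasure_eval {q : ℝ} (hq : 0 < q) (c : ℝ) (i : ℤ) (b : Bool) :
    (blockingMeasure q c).real {z | z i = b} = (blockingMarginal q c i).real {b} := by
  have := isProbabilityMeasure_blockingMarginal hq c
  rw [← (measurePreserving_eval_infinitePi (blockingMarginal q c) i).measureReal_preimage
    (measurableSet_singleton b).nullMeasurableSet]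
  rfl

/-- If two neighbours disagree, one of them is a hole and one is a particle. Holes are exponentially
rare towards +∞ and particles towards −∞, so a geometric series dominates on each side. -/
theorem summable_blockingMeasure_ne {q : ℝ} (hq0 : 0 < q) (hq1 : q < 1) (c : ℝ) :
    Summable fun i : ℤ => (blockingMeasure q c).real {z | z i ≠ z (i + 1)} := by
  have := isProbabilityMeasure_blockingMeasure hq0 c
  have key : ∀ (i : ℤ) (b : Bool), (blockingMeasure q c).real {z | z i ≠ z (i + 1)} ≤
      (blockingMarginal q c i).real {b} + (blockingMarginal q c (i + 1)).real {b} := fun i b => by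
    rw [← blockingMeasure_eval hq0, ← blockingMeasure_eval hq0]
    refine (measureReal_mono fun z hz => ?_).trans (measureReal_union_le _ _)
    simp only [Set.mem_ofPred_eq, Set.mem_union] at hz ⊢
    revert hz
    cases z i <;> cases z (i + 1) <;> cases b <;> simp
  have geom := summable_geometric_of_lt_one hq0.le hq1
  have hpow : ∀ (a : ℝ) (n : ℕ), q ^ (a + n) = q ^ a * q ^ n := fun a n => by
    rw [Real.rpow_add hq0, Real.rpow_natCast]
  have hle : ∀ a : ℝ, q ^ a / (1 + q ^ a) ≤ q ^ a := fun a =>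
    have := Real.rpow_pos_of_pos hq0 a
    div_le_self this.le (by linarith)
  have hle' : ∀ a : ℝ, 1 / (1 + q ^ a) ≤ q ^ (-a) := fun a => by
    have := Real.rpow_pos_of_pos hq0 a
    rw [Real.rpow_neg hq0.le, ← one_div]
    exact one_div_le_one_div_of_le this (by linarith)
  refine Summable.of_nat_of_neg ?_ ?_
  · refine Summable.of_nonneg_of_le (fun _ => measureReal_nonneg) (fun n => key n false)
      (Summable.of_nonneg_of_le (fun _ => by positivity) (fun n => ?_)
        (geom.mul_left (q ^ (-c) + q ^ (-c + 1))))
    rw [blockingMarginal_real_false hq0, blockingMarginal_real_false hq0, add_mul, ← hpow, ← hpow]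
    refine add_le_add ((hle' _).trans_eq ?_) ((hle' _).trans_eq ?_) <;>
    · congr 1
      push_cast
      ring
  · refine Summable.of_nonneg_of_le (fun _ => measureReal_nonneg) (fun n => key (-n) true)
      (Summable.of_nonneg_of_le (fun _ => by positivity) (fun n => ?_)
        (geom.mul_left (q ^ c + q ^ (c - 1))))
    rw [blockingMarginal_real_true hq0, blockingMarginal_real_true hq0, add_mul, ← hpow, ← hpow]
    refine add_le_add ((hle _).trans_eq ?_) ((hle _).trans_eq ?_) <;>
    · congr 1
      push_cast
      ring

/-! ### Moments over finite windows. -/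

theorem integral_blockingMarginal {q : ℝ} (hq : 0 < q) (c : ℝ) (i : ℤ) (f : Bool → ℝ) :
    ∫ b, f b ∂(blockingMarginal q c i) = (q ^ (c - i) * f true + f false) / (1 + q ^ (c - i)) := by
  have := isProbabilityMeasure_blockingMarginal hq c i
  rw [integral_fintype (.of_finite), Fintype.sum_bool, blockingMarginal_real_true hq,
    blockingMarginal_real_false hq]
  simp only [smul_eq_mul]
  ring

theorem integral_prod_blockingMeasure {q : ℝ} (hq : 0 < q) (c : ℝ) (m : ℤ) (f : ℕ → Bool → ℝ)
    (n : ℕ) : ∫ z, ∏ k ∈ Finset.range n, f k (z (m - k)) ∂(blockingMeasure q c) =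
      ∏ k ∈ Finset.range n, ∫ b, f k b ∂(blockingMarginal q c (m - k)) := by
  have := isProbabilityMeasure_blockingMarginal hq c
  have hind := ProbabilityTheory.iIndepFun_infinitePi (P := blockingMarginal q c)
    (X := fun _ b => b) (fun _ => measurable_id)
  have hinj : Function.Injective fun k : Fin n => m - (k : ℕ) := fun a b h => by
    ext
    simpa using h
  have h := (hind.precomp hinj).integral_fun_prod_comp (f := fun k : Fin n => f k)
    (fun k => (measurable_pi_apply (m - (k : ℕ))).aemeasurable)
    (fun k => (measurable_of_countable _).aestronglyMeasurable)
  simp_rw [Finset.prod_range]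
  refine h.trans (Finset.prod_congr rfl fun k _ => ?_)
  rw [← (measurePreserving_eval_infinitePi (blockingMarginal q c) (m - k)).map_eq, integral_map]
  · exact (measurable_pi_apply _).aemeasurable
  · exact (measurable_of_countable _).aestronglyMeasurable

/-- The part of `1{z m = 1} q ^ (j * label z m)` visible in the window of length `n` to the left
of `m`. -/
noncomputable def windowWeight (q : ℝ) (m : ℤ) (j n : ℕ) (z : ℤ → Bool) : ℝ :=
  (if z m = true then 1 else 0) * ∏ k ∈ Finset.range n, if z (m - 1 - k) = true then q ^ j else 1

/-- With x = q^(c−m), site m − k has odds x q^k and contributes (1 + x q^(k+j)) / (1 + x q^k). The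
product telescopes, leaving j factors at the far end that tend to 1 as the window grows. -/
theorem integral_windowWeight {q : ℝ} (hq : 0 < q) (c : ℝ) (m : ℤ) (j n : ℕ) :
    ∫ z, windowWeight q m j n z ∂(blockingMeasure q c) =
      q ^ (c - m) * (∏ l ∈ Finset.range (j + 1), (1 + q ^ (c - m) * q ^ l)⁻¹) *
        ∏ l ∈ Finset.range j, (1 + q ^ (c - m) * q ^ (n + 1 + l)) := by
  let f : ℕ → Bool → ℝ := fun k b =>
    if k = 0 then (if b = true then 1 else 0) else if b = true then q ^ j else 1
  have h1 : ∀ z, windowWeight q m j n z =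
      ∏ k ∈ Finset.range (n + 1), f k (z (m - (k : ℕ))) := fun z => by
    rw [windowWeight, Finset.prod_range_succ']
    simp only [f]
    simp only [Nat.add_eq_zero_iff, one_ne_zero, and_false, if_false, if_true, Nat.cast_zero,
      sub_zero, Nat.cast_add, Nat.cast_one, mul_comm, sub_sub, add_comm]
  simp_rw [h1]
  rw [integral_prod_blockingMeasure hq]
  simp_rw [integral_blockingMarginal hq, f]
  have hx : 0 < q ^ (c - m) := Real.rpow_pos_of_pos hq _
  have h2 : ∀ k : ℕ, q ^ (c - ((m - k : ℤ) : ℝ)) = q ^ (c - m) * q ^ k := fun k => by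
    rw [← Real.rpow_natCast q k, ← Real.rpow_add hq]
    congr 1
    push_cast
    ring
  simp_rw [h2]
  generalize q ^ (c - (m : ℝ)) = x at hx
  rw [Finset.prod_range_succ', Finset.prod_range_succ' (fun l => (1 + x * q ^ l)⁻¹) j]
  simp only [Nat.add_eq_zero_iff, one_ne_zero, and_false, if_false, if_true, pow_zero, mul_one,
    Bool.false_eq_true, add_zero]
  -- The telescoping: both sides are the product of the first n + j factors, split after n or after
  -- j.
  have h3 : (∏ k ∈ Finset.range n, (1 + x * q ^ (k + 1))) *
      (∏ l ∈ Finset.range j, (1 + x * q ^ (n + 1 + l))) =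
      (∏ k ∈ Finset.range j, (1 + x * q ^ (k + 1))) *
        ∏ l ∈ Finset.range n, (1 + x * q ^ (l + 1) * q ^ j) := by
    have e1 := Finset.prod_range_add (fun k => 1 + x * q ^ (k + 1)) n j
    have e2 := Finset.prod_range_add (fun k => 1 + x * q ^ (k + 1)) j n
    rw [add_comm j n, e1] at e2
    convert e2 using 3 <;> ring
  have h4 : ∀ n, ∏ k ∈ Finset.range n, (1 + x * q ^ (k + 1)) ≠ 0 := fun n =>
    Finset.prod_ne_zero_iff.2 fun k _ => by positivity
  rw [Finset.prod_div_distrib, Finset.prod_inv_distrib]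
  have h5 : ∏ k ∈ Finset.range n, (x * q ^ (k + 1) * q ^ j + 1) =
      ∏ l ∈ Finset.range n, (1 + x * q ^ (l + 1) * q ^ j) :=
    Finset.prod_congr rfl fun _ _ => add_comm _ _
  rw [h5]
  have := h4 n
  have := h4 j
  field_simp
  linear_combination -h3

theorem tendsto_integral_windowWeight {q : ℝ} (hq0 : 0 < q) (hq1 : q < 1) (c : ℝ) (m : ℤ) (j : ℕ) :
    Tendsto (fun n => ∫ z, windowWeight q m j n z ∂(blockingMeasure q c)) atTop
      (𝓝 (q ^ (c - m) * ∏ l ∈ Finset.range (j + 1), (1 + q ^ (c - m) * q ^ l)⁻¹)) := by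
  simp_rw [integral_windowWeight hq0]
  have h1 : Tendsto (fun n : ℕ => ∏ l ∈ Finset.range j, (1 + q ^ (c - m) * q ^ (n + 1 + l))) atTop
      (𝓝 (∏ l ∈ Finset.range j, (1 + q ^ (c - m) * 0))) := by
    refine tendsto_finsetProd _ fun l _ => ((Tendsto.const_mul _ ?_).const_add _)
    simp_rw [add_assoc]
    exact (tendsto_pow_atTop_nhds_zero_of_lt_one hq0.le hq1).comp (tendsto_add_atTop_nat (1 + l))
  simpa using h1.const_mul (q ^ (c - m) * ∏ l ∈ Finset.range (j + 1), (1 + q ^ (c - m) * q ^ l)⁻¹)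

end ASEP

namespace ASEP

/-! ### The state space -/

instance : Countable BlockingState := by
  have hinj : Function.Injective fun x : BlockingState => (x.2.1.toFinset, x.2.2.toFinset) := by
    intro x y h
    simp only [Prod.mk.injEq, Set.Finite.toFinset_inj, Set.ext_iff, Set.mem_ofPred_eq] at h
    refine Subtype.ext (funext fun i => ?_)
    rcases le_or_gt i 0 with hi | hi
    · have := h.1 i
      simp only [hi, true_and] at this
      exact Bool.eq_iff_iff.2 this
    · have := h.2 i
      simp only [hi, true_and] at this
      revert this
      cases x.1 i <;> cases y.1 i <;> simp
  exact hinj.countable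

variable {d : ℕ}

/-- The finite set of occupied labels. -/
noncomputable def LabelState.labels (g : LabelState d) : Finset ℕ :=
  (Set.finite_of_encard_eq_coe g.2).toFinset

@[simp] theorem LabelState.mem_labels (g : LabelState d) (k : ℕ) :
    k ∈ g.labels ↔ g.1 k = true := by simp [LabelState.labels]

theorem LabelState.card_labels (g : LabelState d) : g.labels.card = d := by
  have h := (Set.finite_of_encard_eq_coe g.2).encard_eq_coe_toFinset_card
  rw [g.2] at h
  exact_mod_cast h.symm

theorem LabelState.labels_injective : Function.Injective (LabelState.labels (d := d)) := by
  intro g g' h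
  refine Subtype.ext (funext fun k => Bool.eq_iff_iff.2 ?_)
  rw [← g.mem_labels, ← g'.mem_labels, h]

theorem LabelState.range_labels :
    Set.range (LabelState.labels (d := d)) = {S | S.card = d} := by
  ext S
  constructor
  · rintro ⟨g, rfl⟩
    exact g.card_labels
  · intro hS
    refine ⟨⟨fun k => decide (k ∈ S), ?_⟩, ?_⟩
    · have : {k : ℕ | decide (k ∈ S) = true} = (S : Set ℕ) := by ext; simp
      rw [this, Set.encard_coe_eq_coe_finsetCard, hS]
    · ext k
      simp

instance : Countable (LabelState d) := LabelState.labels_injective.countable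

theorem LabelState.tsum_labels (F : Finset ℕ → ℝ) :
    ∑' g : LabelState d, F g.labels = ∑' S, if S.card = d then F S else 0 := by
  rw [← (LabelState.labels_injective (d := d)).tsum_eq]
  · simp [LabelState.card_labels]
  · rw [LabelState.range_labels]
    intro S hS
    by_contra h
    exact hS (if_neg h)

/-- The transition of the coupled system over an edge of `ℤ` or of `ℤ_{≥0}`. -/
def CoupledState.move (x : CoupledState d) : ℤ ⊕ ℕ → CoupledState d
  | .inl i => (x.1.jump i, x.2)
  | .inr i => (x.1, x.2.jump i)

open Classical in
/-- The rate of the transition over an edge of `ℤ` or of `ℤ_{≥0}`. -/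
noncomputable def CoupledState.rate (q : ℝ) (x : CoupledState d) : ℤ ⊕ ℕ → ℝ
  | .inl i => edgeRate 1 q (x.1.1 i) (x.1.1 (i + 1))
  | .inr i => if LabelsAdjacent x.1.1 i then edgeRate q 1 (x.2.1 i) (x.2.1 (i + 1)) else 0

/-- The occupations at the ends of an edge differ. -/
def CoupledState.Active (x : CoupledState d) : ℤ ⊕ ℕ → Prop
  | .inl i => x.1.1 i ≠ x.1.1 (i + 1)
  | .inr i => x.2.1 i ≠ x.2.1 (i + 1)

theorem BlockingState.jump_jump (x : BlockingState) (i : ℤ) : (x.jump i).jump i = x :=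
  Subtype.ext (exchange_exchange _ _)

theorem LabelState.jump_jump (g : LabelState d) (i : ℕ) : (g.jump i).jump i = g :=
  Subtype.ext (exchange_exchange _ _)

theorem CoupledState.move_move (x : CoupledState d) (e : ℤ ⊕ ℕ) : (x.move e).move e = x := by
  cases e
  · exact Prod.ext (BlockingState.jump_jump _ _) rfl
  · exact Prod.ext rfl (LabelState.jump_jump _ _)

theorem CoupledState.move_eq_self {x : CoupledState d} {e : ℤ ⊕ ℕ} (h : ¬x.Active e) :
    x.move e = x := by
  cases e
  · exact Prod.ext (Subtype.ext (exchange_eq_self (not_not.1 h))) rfl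
  · exact Prod.ext rfl (Subtype.ext (exchange_eq_self (not_not.1 h)))

theorem edgeRate_self (r l : ℝ) (a : Bool) : edgeRate r l a a = 0 := by
  cases a <;> simp [edgeRate]

theorem edgeRate_nonneg {r l : ℝ} (hr : 0 ≤ r) (hl : 0 ≤ l) (a b : Bool) : 0 ≤ edgeRate r l a b := by
  cases a <;> cases b <;> simp [edgeRate, hr, hl]

theorem edgeRate_pos {r l : ℝ} (hr : 0 < r) (hl : 0 < l) {a b : Bool} (h : a ≠ b) :
    0 < edgeRate r l a b := by
  revert h
  cases a <;> cases b <;> simp [edgeRate, hr, hl]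

theorem edgeRate_le {r l : ℝ} (hr : r ≤ 1) (hl : l ≤ 1) (a b : Bool) :
    edgeRate r l a b ≤ if a ≠ b then 1 else 0 := by
  cases a <;> cases b <;> simp [edgeRate, hr, hl]

theorem CoupledState.rate_eq_zero (q : ℝ) {x : CoupledState d} {e : ℤ ⊕ ℕ} (h : ¬x.Active e) :
    x.rate q e = 0 := by
  cases e
  · simp only [rate, not_not.1 h, edgeRate_self]
  · simp only [rate, not_not.1 h, edgeRate_self, ite_self]

theorem CoupledState.rate_nonneg {q : ℝ} (hq : 0 ≤ q) (x : CoupledState d) (e : ℤ ⊕ ℕ) :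
    0 ≤ x.rate q e := by
  cases e
  · exact edgeRate_nonneg zero_le_one hq _ _
  · simp only [rate]
    split_ifs
    exacts [edgeRate_nonneg hq zero_le_one _ _, le_rfl]

theorem BlockingState.finite_active (x : BlockingState) : {i : ℤ | x.1 i ≠ x.1 (i + 1)}.Finite := by
  obtain ⟨h1, h2⟩ := x.2
  have h3 := h1.preimage ((add_left_injective (1 : ℤ)).injOn)
  have h4 := h2.preimage ((add_left_injective (1 : ℤ)).injOn)
  refine (((h1.union h2).union (h3.union h4)).union (Set.finite_singleton 0)).subset fun i hi => ?_
  simp only [Set.mem_union, Set.mem_preimage, Set.mem_ofPred_eq, Set.mem_singleton_iff] at hi ⊢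
  rcases lt_trichotomy i 0 with h | h | h
  · have h5 : i ≤ 0 := h.le
    have h6 : i + 1 ≤ 0 := h
    simp only [h5, h6, true_and]
    revert hi
    cases x.1 i <;> cases x.1 (i + 1) <;> simp
  · exact Or.inr h
  · have h6 : 0 < i + 1 := by omega
    simp only [h, h6, true_and]
    revert hi
    cases x.1 i <;> cases x.1 (i + 1) <;> simp

theorem LabelState.finite_active (g : LabelState d) : {i : ℕ | g.1 i ≠ g.1 (i + 1)}.Finite := by
  have h1 := Set.finite_of_encard_eq_coe g.2
  have h3 := h1.preimage ((add_left_injective (1 : ℕ)).injOn)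
  refine (h1.union h3).subset fun i hi => ?_
  simp only [Set.mem_union, Set.mem_preimage, Set.mem_ofPred_eq] at hi ⊢
  revert hi
  cases g.1 i <;> cases g.1 (i + 1) <;> simp

theorem CoupledState.finite_active (x : CoupledState d) : {e | x.Active e}.Finite := by
  refine ((x.1.finite_active.image Sum.inl).union (x.2.finite_active.image Sum.inr)).subset ?_
  rintro (i | i) hi
  · exact Or.inl ⟨i, hi, rfl⟩
  · exact Or.inr ⟨i, hi, rfl⟩

theorem generator_eq_tsum (q : ℝ) (f : CoupledState d → ℝ) (x : CoupledState d) :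
    generator q f x = ∑' e, x.rate q e * (f (x.move e) - f x) := by
  have h : Summable fun e => x.rate q e * (f (x.move e) - f x) :=
    summable_of_hasFiniteSupport (x.finite_active.subset fun e he => by
      by_contra h
      exact he (by simp only [x.rate_eq_zero q h, zero_mul]))
  rw [Summable.tsum_sum (h.comp_injective Sum.inl_injective)
    (h.comp_injective Sum.inr_injective)]
  rfl

/-- The generator of the indicator of a state is a finite combination of indicators. -/
theorem generator_single (q : ℝ) (y x : CoupledState d) :
    generator q (Set.indicator {y} 1) x = ∑ e ∈ y.finite_active.toFinset,
      ((y.move e).rate q e * Set.indicator {y.move e} 1 x -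
        y.rate q e * Set.indicator {y} 1 x) := by
  classical
  have hmove : ∀ e, x.move e = y ↔ x = y.move e := fun e =>
    ⟨fun h => by rw [← h, x.move_move], fun h => by rw [h, y.move_move]⟩
  rw [generator_eq_tsum, tsum_eq_sum (s := y.finite_active.toFinset)]
  · refine Finset.sum_congr rfl fun e _ => ?_
    simp only [Set.indicator_apply, Set.mem_singleton_iff, hmove, Pi.one_apply, mul_sub]
    congr 1
    · split_ifs with h
      exacts [by rw [h], by simp]
    · split_ifs with h
      exacts [by rw [h], by simp]
  · intro e he
    have he' : ¬y.Active e := by simpa using he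
    by_cases h : x = y
    · rw [h, y.rate_eq_zero q he', zero_mul]
    · simp [hmove, y.move_eq_self he', h]

/-! ### Reversibility -/

/-- The reversible weight of the coupled system: the blocking measure times the weight of the
occupied labels. -/
noncomputable def CoupledState.weight (q c : ℝ) (x : CoupledState d) : ℝ :=
  (blockingMeasure q c).real {x.1.1} * labelWeight q x.2.labels

theorem blockingMeasure_mul_edgeRate {q : ℝ} (hq : 0 < q) (c : ℝ) (z : ℤ → Bool) (i : ℤ) :
    (blockingMeasure q c).real {exchange z i} *
        edgeRate 1 q (exchange z i i) (exchange z i (i + 1)) =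
      (blockingMeasure q c).real {z} * edgeRate 1 q (z i) (z (i + 1)) := by
  rcases h1 : z i with _ | _ <;> rcases h2 : z (i + 1) with _ | _
  · rw [exchange_eq_self (h1.trans h2.symm), h1, h2]
  · have h := blockingMeasure_detailed_balance hq c (exchange z i) i (by rw [exchange_left, h2])
      (by rw [exchange_right, h1])
    rw [exchange_exchange] at h
    rw [exchange_left, exchange_right, h1, h2, h]
    simp [edgeRate, mul_comm]
  · have h := blockingMeasure_detailed_balance hq c z i h1 h2
    rw [exchange_left, exchange_right, h1, h2, h]
    simp [edgeRate, mul_comm]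
  · rw [exchange_eq_self (h1.trans h2.symm), h1, h2]

theorem labels_jump (g : LabelState d) (i : ℕ) :
    (g.jump i).labels = g.labels.map (Equiv.swap i (i + 1)).toEmbedding := by
  ext k
  simp [LabelState.jump, exchange, Finset.mem_map_equiv]

theorem labelWeight_jump (q : ℝ) (g : LabelState d) (i : ℕ) (h1 : g.1 i = true)
    (h2 : g.1 (i + 1) = false) :
    labelWeight q (g.jump i).labels = q * labelWeight q g.labels := by
  have hi : i ∈ g.labels := by simpa using h1
  rw [labels_jump, labelWeight, labelWeight, Finset.prod_map, ← Finset.mul_prod_erase _ _ hi,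
    ← Finset.mul_prod_erase g.labels _ hi, ← mul_assoc]
  congr 1
  · simp [pow_succ, mul_comm]
  · refine Finset.prod_congr rfl fun k hk => ?_
    rw [Finset.mem_erase, LabelState.mem_labels] at hk
    have h3 : k ≠ i + 1 := fun h => by simp [h, h2] at hk
    simp [Equiv.swap_apply_of_ne_of_ne hk.1 h3]

theorem labelWeight_mul_edgeRate (q : ℝ) (g : LabelState d) (i : ℕ) :
    labelWeight q (g.jump i).labels * edgeRate q 1 ((g.jump i).1 i) ((g.jump i).1 (i + 1)) =
      labelWeight q g.labels * edgeRate q 1 (g.1 i) (g.1 (i + 1)) := by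
  have hl : (g.jump i).1 i = g.1 (i + 1) := exchange_left _ _
  have hr : (g.jump i).1 (i + 1) = g.1 i := exchange_right _ _
  rcases h1 : g.1 i with _ | _ <;> rcases h2 : g.1 (i + 1) with _ | _
  · rw [hl, hr, h1, h2, edgeRate_self, mul_zero, mul_zero]
  · have h := labelWeight_jump q (g.jump i) i (by rw [hl, h2]) (by rw [hr, h1])
    rw [LabelState.jump_jump] at h
    rw [hl, hr, h1, h2, h]
    simp [edgeRate, mul_comm]
  · rw [hl, hr, h1, h2, labelWeight_jump q g i h1 h2]
    simp [edgeRate, mul_comm]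
  · rw [hl, hr, h1, h2, edgeRate_self, mul_zero, mul_zero]

/-- A jump of ξ leaves γ fixed, and a jump of γ leaves ξ fixed and with it the adjacency constraint,
so each factor of the weight is balanced separately. -/
theorem CoupledState.weight_mul_rate {q : ℝ} (hq : 0 < q) (c : ℝ) (x : CoupledState d)
    (e : ℤ ⊕ ℕ) :
    (x.move e).weight q c * (x.move e).rate q e = x.weight q c * x.rate q e := by
  rcases e with i | i
  · have h := blockingMeasure_mul_edgeRate hq c x.1.1 i
    simp only [weight, rate, move, BlockingState.jump]
    linear_combination labelWeight q x.2.labels * h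
  · have h := labelWeight_mul_edgeRate q x.2 i
    by_cases ha : LabelsAdjacent x.1.1 i
    · have ha' : LabelsAdjacent (x.move (.inr i)).1.1 i := ha
      simp only [weight, rate, if_pos ha, if_pos ha']
      simp only [move]
      linear_combination (blockingMeasure q c).real {x.1.1} * h
    · have ha' : ¬LabelsAdjacent (x.move (.inr i)).1.1 i := ha
      simp only [rate, if_neg ha, if_neg ha', mul_zero]

/-! ### Summability of the conductances -/

theorem summable_labelWeight_labels {q : ℝ} (hq0 : 0 < q) (hq1 : q < 1) :
    Summable fun g : LabelState d => labelWeight q g.labels :=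
  (summable_labelWeight hq0 hq1).comp_injective LabelState.labels_injective

/-- An active edge has an occupied end, so d labels give at most 2d active edges. -/
theorem summable_labelWeight_active {q : ℝ} (hq0 : 0 < q) (hq1 : q < 1) :
    Summable fun p : LabelState d × ℕ =>
      labelWeight q p.1.labels * if p.1.1 p.2 ≠ p.1.1 (p.2 + 1) then 1 else 0 := by
  have h1 : Summable fun p : LabelState d × ℕ =>
      labelWeight q p.1.labels * if p.2 ∈ p.1.labels then 1 else 0 := by
    refine (summable_prod_of_nonneg fun p => ?_).2 ⟨fun g => ?_, ?_⟩
    · have := labelWeight_pos hq0 p.1.labels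
      positivity
    · refine summable_of_hasFiniteSupport (g.labels.finite_toSet.subset fun k hk => ?_)
      by_contra h
      exact hk (by simp_all)
    · refine ((summable_labelWeight_labels hq0 hq1).mul_right (d : ℝ)).congr fun g => ?_
      dsimp only
      rw [tsum_mul_left, tsum_eq_sum (s := g.labels) fun k hk => if_neg hk, Finset.sum_ite_mem,
        Finset.inter_self, Finset.sum_const, g.card_labels, nsmul_one]
  have h2 : Function.Injective fun p : LabelState d × ℕ => (p.1, p.2 + 1) := by
    rintro ⟨a, b⟩ ⟨a', b'⟩ h
    simpa using h
  refine Summable.of_nonneg_of_le (fun p => ?_) (fun p => ?_) (h1.add (h1.comp_injective h2))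
  · have := labelWeight_pos hq0 p.1.labels
    positivity
  · have := labelWeight_pos hq0 p.1.labels
    simp only [Function.comp_apply, ← mul_add]
    refine mul_le_mul_of_nonneg_left ?_ this.le
    simp only [LabelState.mem_labels]
    cases p.1.1 p.2 <;> cases p.1.1 (p.2 + 1) <;> simp

theorem sum_measureReal_singleton_le {q : ℝ} (hq : 0 < q) (c : ℝ) (p : (ℤ → Bool) → Prop)
    [DecidablePred p] (s : Finset BlockingState) :
    ∑ x ∈ s, ((blockingMeasure q c).real {x.1} * if p x.1 then 1 else 0) ≤
      (blockingMeasure q c).real {z | p z} := by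
  have := isProbabilityMeasure_blockingMeasure hq c
  simp only [mul_ite, mul_one, mul_zero]
  have h := Finset.sum_map (s.filter fun x => p x.1) (Function.Embedding.subtype _)
    fun z => (blockingMeasure q c).real {z}
  simp only [Function.Embedding.subtype_apply] at h
  rw [← Finset.sum_filter, ← h, sum_measureReal_singleton]
  refine measureReal_mono fun z hz => ?_
  simp only [Finset.coe_map, Set.mem_image, Finset.mem_coe, Finset.mem_filter] at hz
  obtain ⟨x, hx, rfl⟩ := hz
  exact hx.2

theorem summable_measureReal_singleton {q : ℝ} (hq : 0 < q) (c : ℝ) :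
    Summable fun x : BlockingState => (blockingMeasure q c).real {x.1} :=
  summable_of_sum_le (fun _ => measureReal_nonneg) fun s => by
    simpa using sum_measureReal_singleton_le hq c (fun _ => True) s

/-- Summing over configurations first bounds the contribution of edge i by the probability that its
ends disagree. -/
theorem summable_blockingMeasure_active {q : ℝ} (hq0 : 0 < q) (hq1 : q < 1) (c : ℝ) :
    Summable fun p : BlockingState × ℤ =>
      (blockingMeasure q c).real {p.1.1} * if p.1.1 p.2 ≠ p.1.1 (p.2 + 1) then 1 else 0 := by
  have hle := fun i : ℤ => sum_measureReal_singleton_le hq0 c fun z => z i ≠ z (i + 1)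
  have hnn : ∀ (x : BlockingState) (i : ℤ), (0 : ℝ) ≤
      (blockingMeasure q c).real {x.1} * if x.1 i ≠ x.1 (i + 1) then 1 else 0 :=
    fun x i => by positivity
  rw [← (Equiv.prodComm ℤ BlockingState).summable_iff]
  refine (summable_prod_of_nonneg fun p => hnn p.2 p.1).2 ⟨fun i => ?_, ?_⟩
  · exact summable_of_sum_le (fun x => hnn x i) (hle i)
  · exact Summable.of_nonneg_of_le (fun i => tsum_nonneg fun x => hnn x i)
      (fun i => Real.tsum_le_of_sum_le (fun x => hnn x i) (hle i))
      (summable_blockingMeasure_ne hq0 hq1 c)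

theorem summable_weight_mul_rate {q : ℝ} (hq0 : 0 < q) (hq1 : q < 1) (c : ℝ) :
    Summable fun p : CoupledState d × (ℤ ⊕ ℕ) => p.1.weight q c * p.1.rate q p.2 := by
  have hw : ∀ x : CoupledState d, 0 ≤ x.weight q c := fun x =>
    mul_nonneg measureReal_nonneg (labelWeight_pos hq0 _).le
  have hW : ∀ g : LabelState d, 0 ≤ labelWeight q g.labels := fun g => (labelWeight_pos hq0 _).le
  rw [← (Equiv.prodSumDistrib _ _ _).symm.summable_iff]
  refine Summable.sum _ ?_ ?_
  · have h := (summable_blockingMeasure_active hq0 hq1 c).mul_of_nonneg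
      (summable_labelWeight_labels (d := d) hq0 hq1) (fun _ => by positivity) hW
    have hinj : Function.Injective fun p : CoupledState d × ℤ => ((p.1.1, p.2), p.1.2) := by
      rintro ⟨⟨a, b⟩, c⟩ ⟨⟨a', b'⟩, c'⟩ h
      simp_all
    refine Summable.of_nonneg_of_le (fun p => mul_nonneg (hw _) (CoupledState.rate_nonneg hq0.le _ _))
      (fun p => ?_) (h.comp_injective hinj)
    have h1 := edgeRate_le le_rfl hq1.le (p.1.1.1 p.2) (p.1.1.1 (p.2 + 1))
    refine (mul_le_mul_of_nonneg_left h1 (hw p.1)).trans_eq ?_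
    simp only [CoupledState.weight, Function.comp_apply]
    ring
  · have h := (summable_measureReal_singleton hq0 c).mul_of_nonneg
      (summable_labelWeight_active (d := d) hq0 hq1) (fun _ => measureReal_nonneg)
      (fun p => mul_nonneg (hW _) (by positivity))
    have hinj : Function.Injective fun p : CoupledState d × ℕ => (p.1.1, (p.1.2, p.2)) := by
      rintro ⟨⟨a, b⟩, c⟩ ⟨⟨a', b'⟩, c'⟩ h
      simp_all
    refine Summable.of_nonneg_of_le (fun p => mul_nonneg (hw _) (CoupledState.rate_nonneg hq0.le _ _))
      (fun p => ?_) (h.comp_injective hinj)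
    have h1 : p.1.rate q (.inr p.2) ≤ if p.1.2.1 p.2 ≠ p.1.2.1 (p.2 + 1) then 1 else 0 := by
      simp only [CoupledState.rate]
      refine le_trans ?_ (edgeRate_le hq1.le le_rfl (p.1.2.1 p.2) (p.1.2.1 (p.2 + 1)))
      split_ifs
      exacts [le_rfl, edgeRate_nonneg hq0.le zero_le_one _ _]
    refine (mul_le_mul_of_nonneg_left h1 (hw p.1)).trans_eq ?_
    simp only [CoupledState.weight, Function.comp_apply]
    ring

end ASEP

namespace ASEP

variable {d : ℕ}

/-! ### Particles and their labels -/

theorem finite_label {z : ℤ → Bool} (hz : IsBlocking z) (j : ℤ) :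
    {k : ℤ | k < j ∧ z k = true}.Finite := by
  refine (hz.1.union (Set.finite_Ico 0 j)).subset ?_
  rintro k ⟨hk, hzk⟩
  rcases le_or_gt k 0 with h | h
  · exact Or.inl ⟨h, hzk⟩
  · exact Or.inr ⟨h.le, hk⟩

theorem exists_particle_after {z : ℤ → Bool} (hz : IsBlocking z) (a : ℤ) :
    ∃ n : ℕ, z (a + n + 1) = true ∧ ∀ k, a < k → k < a + n + 1 → z k = false := by
  have hex : ∃ n : ℕ, z (a + n + 1) = true := by
    obtain ⟨B, hB⟩ := hz.2.bddAbove
    -- This choice makes a + n + 1 ≥ |B| + 1, a positive site beyond the last hole.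
    refine ⟨(|B| + |a|).toNat, ?_⟩
    by_contra h
    have h1 := abs_nonneg B
    have h2 := le_abs_self B
    have h3 := neg_abs_le a
    have h4 : a + (|B| + |a|).toNat + 1 ≤ B := hB ⟨by omega, by simpa using h⟩
    omega
  classical
  refine ⟨Nat.find hex, Nat.find_spec hex, fun k hk1 hk2 => ?_⟩
  have h := Nat.find_min hex (m := (k - a - 1).toNat) (by omega)
  have h2 : a + ((k - a - 1).toNat : ℤ) + 1 = k := by omega
  rwa [h2, Bool.not_eq_true] at h

theorem exists_particle_label {z : ℤ → Bool} (hz : IsBlocking z) (i : ℕ) :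
    ∃ a, z a = true ∧ label z a = i := by
  induction i with
  | zero =>
    obtain ⟨B, hB⟩ := hz.1.bddBelow
    obtain ⟨n, hn, -⟩ := exists_particle_after hz 0
    obtain ⟨a, ha, hmin⟩ := Int.exists_least_of_bdd (P := fun k => z k = true)
      ⟨min B 0, fun k hk => by
        rcases le_or_gt k 0 with h | h
        · exact (min_le_left _ _).trans (hB ⟨h, hk⟩)
        · exact (min_le_right _ _).trans h.le⟩ ⟨_, hn⟩
    refine ⟨a, ha, ?_⟩
    have : {k : ℤ | k < a ∧ z k = true} = ∅ :=
      Set.eq_empty_of_forall_notMem fun k hk => (hmin k hk.2).not_gt hk.1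
    rw [label, this, Set.ncard_empty]
  | succ i ih =>
    obtain ⟨a, ha, hl⟩ := ih
    obtain ⟨n, hn, hgap⟩ := exists_particle_after hz a
    refine ⟨_, hn, ?_⟩
    have : {k : ℤ | k < a + n + 1 ∧ z k = true} = insert a {k : ℤ | k < a ∧ z k = true} := by
      ext k
      simp only [Set.mem_ofPred_eq, Set.mem_insert_iff]
      constructor
      · rintro ⟨h1, h2⟩
        rcases lt_trichotomy k a with h | h | h
        · exact Or.inr ⟨h, h2⟩
        · exact Or.inl h
        · simp [hgap k h h1] at h2
      · rintro (rfl | ⟨h1, h2⟩)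
        · exact ⟨by omega, ha⟩
        · exact ⟨by omega, h2⟩
    rw [label, this, Set.ncard_insert_of_notMem (by simp) (finite_label hz a), ← label, hl]

theorem label_exchange (z : ℤ → Bool) {a j : ℤ} (h : a ≤ j) :
    label (exchange z j) a = label z a := by
  have : {k : ℤ | k < a ∧ exchange z j k = true} = {k : ℤ | k < a ∧ z k = true} := by
    ext k
    simp only [Set.mem_ofPred_eq, and_congr_right_iff]
    intro hk
    rw [exchange_of_ne z (by omega) (by omega)]
  rw [label, this, label]

/-! ### Connectedness of the label configurations -/

/-- Moving a label left into a hole lowers the sum of the labels, so every configuration descends to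
the packed one {0, …, d − 1}. -/
theorem LabelState.eq_of_forall_jump {α : Type*} {F : LabelState d → α}
    (hF : ∀ g i, F (g.jump i) = F g) (g g' : LabelState d) : F g = F g' := by
  obtain ⟨g₀, hg₀⟩ : Finset.range d ∈ Set.range (LabelState.labels (d := d)) := by
    rw [LabelState.range_labels]
    simp
  have key : ∀ (n : ℕ) (g : LabelState d), ∑ k ∈ g.labels, k = n → F g = F g₀ := by
    intro n
    induction n using Nat.strong_induction_on with
    | _ n ih =>
      intro g hn
      by_cases h : ∃ i, g.1 i = false ∧ g.1 (i + 1) = true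
      · obtain ⟨i, h1, h2⟩ := h
        rw [← hF g i]
        refine ih _ ?_ _ rfl
        have hi : i + 1 ∈ g.labels := by simpa using h2
        rw [← hn, labels_jump, Finset.sum_map, ← Finset.add_sum_erase _ _ hi,
          ← Finset.add_sum_erase g.labels _ hi]
        refine add_lt_add_of_lt_of_le (by simp) (Finset.sum_le_sum fun k hk => ?_)
        rw [Finset.mem_erase, LabelState.mem_labels] at hk
        have h3 : k ≠ i := fun h => by simp [h, h1] at hk
        simp [Equiv.swap_apply_of_ne_of_ne h3 hk.1]
      -- With no hole immediately to the left of a label, the occupied labels form an initial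
      -- segment.
      · have hdown : ∀ k i, g.1 (i + k) = true → g.1 i = true := by
          intro k
          induction k with
          | zero => exact fun _ h => h
          | succ k ihk =>
            intro i hi
            refine ihk i ?_
            by_contra h'
            exact h ⟨i + k, by simpa using h', hi⟩
        have hsub : g.labels ⊆ Finset.range d := fun k hk => by
          have : Finset.range (k + 1) ⊆ g.labels := fun j hj => by
            rw [Finset.mem_range] at hj
            rw [LabelState.mem_labels] at hk ⊢
            exact hdown (k - j) j (by rwa [Nat.add_sub_cancel' (by omega)])
          have := Finset.card_le_card this
          rw [Finset.card_range, g.card_labels] at this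
          simpa using this
        have heq := Finset.eq_of_subset_of_card_le hsub (by rw [g.card_labels]; simp)
        rw [LabelState.labels_injective (heq.trans hg₀.symm)]
  rw [key _ g rfl, key _ g' rfl]

/-! ### Functions constant along the edges -/

theorem blockingMeasure_exchange_ne_zero {q : ℝ} (hq : 0 < q) (c : ℝ) {z : ℤ → Bool}
    (hz : (blockingMeasure q c).real {z} ≠ 0) (i : ℤ) :
    (blockingMeasure q c).real {exchange z i} ≠ 0 := by
  by_cases h : z i = z (i + 1)
  · rwa [exchange_eq_self h]
  · intro h0
    have h1 := blockingMeasure_mul_edgeRate hq c z i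
    rw [h0, zero_mul] at h1
    exact mul_ne_zero hz (edgeRate_pos one_pos hq h).ne' h1.symm

section

variable {q c : ℝ} {h : CoupledState d → ℝ}

theorem apply_move_inl (hq : 0 < q)
    (hh : ∀ (x : CoupledState d) e, x.weight q c * x.rate q e ≠ 0 → h (x.move e) = h x)
    (x : CoupledState d) (hx : (blockingMeasure q c).real {x.1.1} ≠ 0) (j : ℤ) :
    h (x.move (.inl j)) = h x := by
  by_cases hact : x.Active (.inl j)
  · exact hh _ _ (mul_ne_zero (mul_ne_zero hx (labelWeight_pos hq _).ne')
      (edgeRate_pos one_pos hq hact).ne')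
  · rw [x.move_eq_self hact]

/-- The label exchange may be forbidden in x itself. Induction on the gap n between the two
particles: pull the right one a step closer, exchange there, and push it back. -/
theorem apply_move_inr_of_gap (hq : 0 < q)
    (hh : ∀ (x : CoupledState d) e, x.weight q c * x.rate q e ≠ 0 → h (x.move e) = h x)
    (n : ℕ) (x : CoupledState d) (hx : (blockingMeasure q c).real {x.1.1} ≠ 0) {i : ℕ} {a : ℤ}
    (hi : label x.1.1 a = i) (ha : x.1.1 a = true) (hb : x.1.1 (a + n + 1) = true)
    (hgap : ∀ k, a < k → k < a + n + 1 → x.1.1 k = false) :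
    h (x.move (.inr i)) = h x := by
  induction n generalizing x with
  | zero =>
    by_cases hact : x.Active (.inr i)
    · refine hh _ _ (mul_ne_zero (mul_ne_zero hx (labelWeight_pos hq _).ne') ?_)
      have hadj : LabelsAdjacent x.1.1 i := ⟨a, hi, ha, by simpa using hb⟩
      simp only [CoupledState.rate, if_pos hadj]
      exact (edgeRate_pos hq one_pos hact).ne'
    · rw [x.move_eq_self hact]
  | succ n ih =>
    have hb' : a + (n + 1 : ℕ) + 1 = a + n + 1 + 1 := by push_cast; ring
    rw [hb'] at hb hgap
    have h1 : h ((x.move (.inl (a + n + 1))).move (.inr i)) = h (x.move (.inl (a + n + 1))) := by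
      refine ih (x.move (.inl (a + n + 1))) (blockingMeasure_exchange_ne_zero hq c hx _) ?_ ?_ ?_ ?_
      · exact (label_exchange _ (by omega)).trans hi
      · exact (exchange_of_ne _ (by omega) (by omega)).trans ha
      · exact (exchange_left _ _).trans hb
      · intro k hk1 hk2
        exact (exchange_of_ne _ (by omega) (by omega)).trans (hgap k hk1 (by omega))
    -- Particle moves and label moves act on different components and so commute definitionally;
    -- `h1` is used in this commuted form.
    calc h (x.move (.inr i)) = h ((x.move (.inr i)).move (.inl (a + n + 1))) :=
          (apply_move_inl hq hh (x.move (.inr i)) hx _).symm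
      _ = h x := h1.trans (apply_move_inl hq hh _ hx _)

/-- A function which is constant along the edges of positive conductance does not depend on the
labels. -/
theorem eq_of_constant_along_edges (hq : 0 < q)
    (hh : ∀ (x : CoupledState d) e, x.weight q c * x.rate q e ≠ 0 → h (x.move e) = h x)
    (x : BlockingState) (hx : (blockingMeasure q c).real {x.1} ≠ 0) (g g' : LabelState d) :
    h (x, g) = h (x, g') := by
  refine LabelState.eq_of_forall_jump (F := fun g => h (x, g)) (fun g i => ?_) g g'
  obtain ⟨a, ha, hi⟩ := exists_particle_label x.2 i
  obtain ⟨n, hb, hgap⟩ := exists_particle_after x.2 a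
  exact apply_move_inr_of_gap hq hh n (x, g) hx hi ha hb hgap

end

end ASEP

namespace ASEP

/-! ### Stationary laws -/

section

variable {d : ℕ} {q : ℝ} {Ω : Type*} {mΩ : MeasurableSpace Ω} {P : Measure Ω}
  {𝓕 : Filtration ℝ≥0 mΩ} {Z : ℝ≥0 → Ω → CoupledState d}

theorem IsCoupledProcess.measurable (hZ : IsCoupledProcess q d P 𝓕 Z) (t : ℝ≥0) :
    Measurable (Z t) := (hZ.adapted t).mono (𝓕.le t) le_rfl

variable [IsProbabilityMeasure P]

theorem exists_generator_single_bound (q : ℝ) (y : CoupledState d) :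
    ∃ C, ∀ x, ‖generator q (Set.indicator {y} 1) x‖ ≤ C := by
  have hind : ∀ y x : CoupledState d, ‖Set.indicator {y} (1 : CoupledState d → ℝ) x‖ ≤ 1 :=
    fun y x => (norm_indicator_le_norm_self _ _).trans (by simp)
  refine ⟨∑ e ∈ y.finite_active.toFinset, (‖(y.move e).rate q e‖ * 1 + ‖y.rate q e‖ * 1),
    fun x => ?_⟩
  rw [generator_single]
  refine (norm_sum_le _ _).trans (Finset.sum_le_sum fun e _ => (norm_sub_le _ _).trans ?_)
  rw [norm_mul, norm_mul]
  gcongr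
  exacts [hind _ _, hind _ _]

/-- By stationarity and the martingale property, the time integral of the generator has mean zero
for every t. Dividing by t and letting t → 0 isolates time 0: paths are constant just after 0, and C
dominates. -/
theorem IsCoupledProcess.integral_generator_eq_zero (hZ : IsCoupledProcess q d P 𝓕 Z)
    (hstat : ∀ t, P.map (Z t) = P.map (Z 0)) {f : CoupledState d → ℝ}
    (hf : (Function.support f).Finite) {C : ℝ} (hC : ∀ x, ‖generator q f x‖ ≤ C) :
    ∫ ω, generator q f (Z 0 ω) ∂P = 0 := by
  have hmeas := hZ.measurable
  obtain ⟨B, hB⟩ : ∃ B, ∀ x, ‖f x‖ ≤ B := by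
    refine ⟨∑ x ∈ hf.toFinset, ‖f x‖, fun x => ?_⟩
    by_cases hx : f x = 0
    · rw [hx, norm_zero]
      exact Finset.sum_nonneg fun _ _ => norm_nonneg _
    · exact Finset.single_le_sum (f := fun x => ‖f x‖) (fun _ _ => norm_nonneg _) (by simpa using hx)
  have hfint : ∀ t, Integrable (fun ω => f (Z t ω)) P := fun t =>
    Integrable.of_bound ((measurable_of_countable f).comp (hmeas t)).aestronglyMeasurable B
      (ae_of_all _ fun ω => hB _)
  have hfeq : ∀ t, ∫ ω, f (Z t ω) ∂P = ∫ ω, f (Z 0 ω) ∂P := fun t => by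
    have h : ∀ t, ∫ ω, f (Z t ω) ∂P = ∫ x, f x ∂(P.map (Z t)) := fun t =>
      (integral_map (hmeas t).aemeasurable
        (measurable_of_countable f).aestronglyMeasurable).symm
    rw [h, h, hstat]
  have hM := hZ.martingale f hf
  set I : ℝ≥0 → Ω → ℝ := fun t ω => ∫ s in (0 : ℝ)..t, generator q f (Z s.toNNReal ω) with hI
  have hIint : ∀ t, Integrable (I t) P := fun t => by
    refine (((hfint t).sub (hfint 0)).sub (hM.integrable t)).congr (ae_of_all _ fun ω => ?_)
    simp [I]
  have hI0 : ∀ t, ∫ ω, I t ω ∂P = 0 := fun t => by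
    have h := hM.setIntegral_eq (zero_le : (0 : ℝ≥0) ≤ t) MeasurableSet.univ
    simp only [Measure.restrict_univ, sub_self, NNReal.coe_zero, intervalIntegral.integral_same,
      integral_zero] at h
    have h1 := integral_sub ((hfint t).sub (hfint 0)) (hIint t)
    have h2 := integral_sub (hfint t) (hfint 0)
    simp only [Pi.sub_apply] at h1
    have h3 := hfeq t
    linarith
  have hlim : Tendsto (fun n : ℕ => ∫ ω, ((n : ℝ) + 1) * I (1 / ((n : ℝ≥0) + 1)) ω ∂P) atTop
      (𝓝 (∫ ω, generator q f (Z 0 ω) ∂P)) := by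
    refine tendsto_integral_of_dominated_convergence (fun _ => C)
      (fun n => ((hIint _).const_mul _).aestronglyMeasurable) (integrable_const C)
      (fun n => ae_of_all _ fun ω => ?_) (ae_of_all _ fun ω => ?_)
    · have h := intervalIntegral.norm_integral_le_of_norm_le_const (a := 0)
        (b := ((1 / ((n : ℝ≥0) + 1) : ℝ≥0) : ℝ)) (f := fun s => generator q f (Z s.toNNReal ω))
        (fun s _ => hC _)
      rw [norm_mul, Real.norm_of_nonneg (by positivity : (0 : ℝ) ≤ (n : ℝ) + 1)]
      refine (mul_le_mul_of_nonneg_left h (by positivity)).trans_eq ?_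
      push_cast
      rw [sub_zero, abs_of_nonneg (by positivity)]
      field_simp
    · obtain ⟨ε, hε, hconst⟩ : ∃ ε > 0, ∀ s < ε, Z s ω = Z 0 ω := by
        have h := hZ.right_continuous ω 0
        have hIci : Set.Ici (0 : ℝ≥0) = Set.univ := Set.eq_univ_of_forall fun s => Set.mem_Ici.2 zero_le
        rw [hIci, nhdsWithin_univ] at h
        obtain ⟨ε, hε, h⟩ := (nhds_bot_basis (α := ℝ≥0)).eventually_iff.1 h
        exact ⟨ε, hε, fun s hs => h hs⟩
      refine tendsto_const_nhds.congr' ?_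
      have ht : Tendsto (fun n : ℕ => (1 / ((n : ℝ≥0) + 1) : ℝ≥0)) atTop (𝓝 0) :=
        tendsto_one_div_add_atTop_nhds_zero_nat
      filter_upwards [ht.eventually_lt_const hε] with n hn
      have h : I (1 / ((n : ℝ≥0) + 1)) ω =
          ∫ s in (0 : ℝ)..((1 / ((n : ℝ≥0) + 1) : ℝ≥0) : ℝ), generator q f (Z 0 ω) := by
        refine intervalIntegral.integral_congr fun s hs => ?_
        rw [Set.uIcc_of_le (by positivity)] at hs
        rw [hconst _ (lt_of_le_of_lt (Real.toNNReal_le_iff_le_coe.2 hs.2) hn)]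
      rw [h, intervalIntegral.integral_const, sub_zero, smul_eq_mul, ← mul_assoc]
      push_cast
      rw [mul_one_div_cancel (by positivity), one_mul]
  simp only [integral_const_mul, hI0, mul_zero] at hlim
  exact tendsto_nhds_unique hlim tendsto_const_nhds

/-- Test the generator on the indicator of y: inflow into y equals outflow from y. -/
theorem IsCoupledProcess.global_balance (hZ : IsCoupledProcess q d P 𝓕 Z)
    (hstat : ∀ t, P.map (Z t) = P.map (Z 0)) (y : CoupledState d) :
    ∑' e, ((y.move e).rate q e * (P.map (Z 0)).real {y.move e} -
      y.rate q e * (P.map (Z 0)).real {y}) = 0 := by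
  have hmeas := hZ.measurable 0
  have := Measure.isProbabilityMeasure_map (μ := P) hmeas.aemeasurable
  obtain ⟨C, hC⟩ := exists_generator_single_bound q y
  have h := hZ.integral_generator_eq_zero hstat (f := Set.indicator {y} 1)
    ((Set.finite_singleton y).subset Set.support_indicator_subset) hC
  have hint : ∀ (x : CoupledState d) (r : ℝ),
      Integrable (fun z => r * Set.indicator {x} 1 z) (P.map (Z 0)) :=
    fun x r => ((integrable_const (1 : ℝ)).indicator (measurableSet_singleton x)).const_mul r
  rw [← integral_map (φ := Z 0) hmeas.aemeasurable
    (measurable_of_countable (generator q (Set.indicator {y} 1))).aestronglyMeasurable] at h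
  simp_rw [generator_single] at h
  have hint' : ∀ e ∈ y.finite_active.toFinset, Integrable (fun z =>
      (y.move e).rate q e * Set.indicator {y.move e} 1 z - y.rate q e * Set.indicator {y} 1 z)
      (P.map (Z 0)) := fun e _ => (hint _ _).sub (hint _ _)
  rw [integral_finsetSum _ hint'] at h
  simp_rw [integral_sub (hint _ _) (hint _ _), integral_const_mul,
    integral_indicator_one (measurableSet_singleton _)] at h
  rw [tsum_eq_sum (s := y.finite_active.toFinset), h]
  intro e he
  have he' : ¬y.Active e := by simpa using he
  simp only [y.move_eq_self he', sub_self]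

end

end ASEP

namespace ASEP

/-! ### The label of a site under the blocking measure -/

theorem eventually_windowWeight_eq {z : ℤ → Bool} (hz : IsBlocking z) (q : ℝ) (m : ℤ) (j : ℕ) :
    ∀ᶠ n in atTop, windowWeight q m j n z =
      (if z m = true then 1 else 0) * (q ^ label z m) ^ j := by
  obtain ⟨B, hB⟩ := (finite_label hz m).bddBelow
  -- B bounds from below the particles left of m, so a window of length at least m − B sees all of
  -- them.
  filter_upwards [eventually_ge_atTop (m - B).toNat] with n hn
  have h : {k : ℤ | k < m ∧ z k = true} = (fun k : ℕ => m - 1 - (k : ℤ)) ''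
      ((Finset.range n).filter fun k : ℕ => z (m - 1 - k) = true : Finset ℕ) := by
    ext k
    simp only [Set.mem_ofPred_eq, Set.mem_image, Finset.mem_coe, Finset.mem_filter,
      Finset.mem_range]
    constructor
    · intro hk
      have h1 : B ≤ k := hB hk
      have h2 : m - 1 - ((m - 1 - k).toNat : ℤ) = k := by have := hk.1; omega
      exact ⟨(m - 1 - k).toNat, ⟨by have := hk.1; omega, by rw [h2]; exact hk.2⟩, h2⟩
    · rintro ⟨a, ⟨-, ha⟩, rfl⟩
      exact ⟨by omega, ha⟩
  have hinj : Function.Injective fun k : ℕ => m - 1 - (k : ℤ) := fun a b hab => by simpa using hab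
  rw [windowWeight, label, h, Set.ncard_image_of_injective _ hinj, Set.ncard_coe_finset,
    Finset.prod_ite, Finset.prod_const_one, mul_one, Finset.prod_const, ← pow_mul, ← pow_mul,
    mul_comm j]

theorem abs_windowWeight_le {q : ℝ} (hq0 : 0 < q) (hq1 : q < 1) (m : ℤ) (j n : ℕ) (z : ℤ → Bool) :
    ‖windowWeight q m j n z‖ ≤ 1 := by
  have h1 : ∀ k ∈ Finset.range n, (0 : ℝ) ≤ if z (m - 1 - k) = true then q ^ j else 1 :=
    fun k _ => by positivity
  have h2 : ∀ k ∈ Finset.range n, (if z (m - 1 - k) = true then q ^ j else 1) ≤ 1 := fun k _ => by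
    split_ifs
    exacts [pow_le_one₀ hq0.le hq1.le, le_rfl]
  have h3 := Finset.prod_nonneg h1
  rw [windowWeight, norm_mul, Real.norm_of_nonneg h3]
  refine mul_le_one₀ ?_ h3 (Finset.prod_le_one h1 h2)
  split_ifs <;> simp

theorem measurable_windowWeight (q : ℝ) (m : ℤ) (j n : ℕ) : Measurable (windowWeight q m j n) := by
  have h : ∀ (i : ℤ) (a b : ℝ), Measurable fun z : ℤ → Bool => if z i = true then a else b :=
    fun i a b => (measurable_of_countable fun t : Bool => if t = true then a else b).comp
      (measurable_pi_apply i)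
  exact (h _ _ _).mul (Finset.measurable_fun_prod _ fun k _ => h _ _ _)

theorem integral_label_moment {q : ℝ} (hq0 : 0 < q) (hq1 : q < 1) {c : ℝ} {Ω : Type*}
    {mΩ : MeasurableSpace Ω} {P : Measure Ω} [IsProbabilityMeasure P] {ξ : Ω → ℤ → Bool}
    (hmeas : Measurable ξ) (hblock : ∀ ω, IsBlocking (ξ ω)) (hξ : P.map ξ = blockingMeasure q c)
    (m : ℤ) (j : ℕ) :
    ∫ ω, (if ξ ω m = true then 1 else 0) * (q ^ label (ξ ω) m) ^ j ∂P =
      q ^ (c - m) * ∏ l ∈ Finset.range (j + 1), (1 + q ^ (c - m) * q ^ l)⁻¹ := by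
  have h1 : Tendsto (fun n => ∫ ω, windowWeight q m j n (ξ ω) ∂P) atTop
      (𝓝 (∫ ω, (if ξ ω m = true then 1 else 0) * (q ^ label (ξ ω) m) ^ j ∂P)) :=
    tendsto_integral_of_dominated_convergence (fun _ => 1)
      (fun n => ((measurable_windowWeight q m j n).comp hmeas).aestronglyMeasurable)
      (integrable_const 1) (fun n => ae_of_all _ fun ω => abs_windowWeight_le hq0 hq1 m j n _)
      (ae_of_all _ fun ω => tendsto_const_nhds.congr'
        ((eventually_windowWeight_eq (hblock ω) q m j).mono fun _ h => h.symm))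
  have h2 : ∀ n, ∫ ω, windowWeight q m j n (ξ ω) ∂P =
      ∫ z, windowWeight q m j n z ∂(blockingMeasure q c) := fun n => by
    rw [← hξ, integral_map hmeas.aemeasurable
      (measurable_windowWeight q m j n).aestronglyMeasurable]
  simp_rw [h2] at h1
  exact tendsto_nhds_unique h1 (tendsto_integral_windowWeight hq0 hq1 c m j)

/-! ### Second-class particles -/

section

variable {d : ℕ} {q c : ℝ} {Ω : Type*} {mΩ : MeasurableSpace Ω} {P : Measure Ω}
  [IsProbabilityMeasure P] {𝓕 : Filtration ℝ≥0 mΩ} {Z : ℝ≥0 → Ω → CoupledState d}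

/-- In a stationary law, the conditional law of the labels given the configuration of particles is
proportional to `labelWeight`. -/
theorem IsCoupledProcess.exists_law_eq (hq0 : 0 < q) (hq1 : q < 1)
    (hZ : IsCoupledProcess q d P 𝓕 Z) (hstat : ∀ t, P.map (Z t) = P.map (Z 0))
    (hξ : P.map (fun ω => (Z 0 ω).xi) = blockingMeasure q c) (x : BlockingState) :
    ∃ K, ∀ g : LabelState d, (P.map (Z 0)).real {(x, g)} = K * labelWeight q g.labels := by
  have hmeas := hZ.measurable 0
  have hxi : Measurable fun ω => (Z 0 ω).xi :=
    (measurable_of_countable (CoupledState.xi (d := d))).comp hmeas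
  -- Domination by the ξ-marginal: ν charges no state of zero weight, so dividing by the weight
  -- loses nothing.
  have hle : ∀ x : CoupledState d,
      (P.map (Z 0)).real {x} ≤ (blockingMeasure q c).real {x.1.1} := fun x => by
    rw [← hξ, map_measureReal_apply hmeas (measurableSet_singleton _),
      map_measureReal_apply hxi (measurableSet_singleton _)]
    refine measureReal_mono fun ω hω => ?_
    rw [Set.mem_preimage, Set.mem_singleton_iff] at hω ⊢
    rw [hω, CoupledState.xi]
  by_cases hx : (blockingMeasure q c).real {x.1} = 0
  · exact ⟨0, fun g => by
      rw [zero_mul]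
      exact le_antisymm ((hle (x, g)).trans hx.le) measureReal_nonneg⟩
  obtain ⟨h, hh⟩ : ∃ h : CoupledState d → ℝ, ∀ x, h x = (P.map (Z 0)).real {x} / x.weight q c :=
    ⟨_, fun _ => rfl⟩
  have hν : ∀ x : CoupledState d, (P.map (Z 0)).real {x} = h x * x.weight q c := fun x => by
    by_cases hw : x.weight q c = 0
    · have h1 : (blockingMeasure q c).real {x.1.1} = 0 :=
        (mul_eq_zero.1 hw).resolve_right (labelWeight_pos hq0 _).ne'
      rw [hw, mul_zero]
      exact le_antisymm ((hle x).trans h1.le) measureReal_nonneg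
    · rw [hh, div_mul_cancel₀ _ hw]
  have hw : ∀ x : CoupledState d, 0 ≤ x.weight q c := fun x =>
    mul_nonneg measureReal_nonneg (labelWeight_pos hq0 _).le
  have hconst : ∀ (x : CoupledState d) e, x.weight q c * x.rate q e ≠ 0 → h (x.move e) = h x := by
    intro x e hxe
    refine eq_of_harmonic (c := fun x e => x.weight q c * x.rate q e) (J := fun e x => x.move e)
      (fun e x => x.move_move e) (fun x e => mul_nonneg (hw x) (x.rate_nonneg hq0.le e))
      (fun x e => x.weight_mul_rate hq0 c e) (summable_weight_mul_rate hq0 hq1 c)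
      (fun x => x.finite_active.subset fun e he => ?_)
      (fun x => hh x ▸ div_nonneg measureReal_nonneg (hw x)) (fun y => ?_) hxe
    · by_contra hact
      exact he (by rw [x.rate_eq_zero q hact, mul_zero])
    -- Substituting ν = h · w and using reversibility to replace the inflow conductance by the
    -- outflow one turns global balance into harmonicity of h.
    · rw [← hZ.global_balance hstat y]
      refine tsum_congr fun e => ?_
      rw [hν, hν]
      linear_combination (-h (y.move e)) * y.weight_mul_rate hq0 c e
  by_cases hne : Nonempty (LabelState d)
  · obtain ⟨g₀⟩ := hne
    refine ⟨h (x, g₀) * (blockingMeasure q c).real {x.1}, fun g => ?_⟩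
    rw [hν, eq_of_constant_along_edges hq0 hconst x hx g g₀, CoupledState.weight, mul_assoc]
  · exact ⟨0, fun g => (hne ⟨g⟩).elim⟩

theorem CoupledState.eta_lt_xi_iff (x : CoupledState d) (m : ℤ) :
    x.eta m < x.xi m ↔ x.1.1 m = true ∧ label x.1.1 m ∈ x.2.labels := by
  rw [LabelState.mem_labels]
  simp only [CoupledState.eta, CoupledState.xi, Bool.lt_iff]
  cases x.1.1 m <;> cases x.2.1 (label x.1.1 m) <;> simp

/-- Both sides are disintegrated over ξ. For fixed ξ the unknown constant K multiplies `labelSumMem`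
on one side and `labelSum` times the density on the other, so it need not be computed. -/
theorem IsCoupledProcess.measureReal_second_class (hq0 : 0 < q) (hq1 : q < 1)
    (hZ : IsCoupledProcess q d P 𝓕 Z) (hstat : ∀ t, P.map (Z t) = P.map (Z 0))
    (hξ : P.map (fun ω => (Z 0 ω).xi) = blockingMeasure q c) (m : ℤ) :
    P.real {ω | (Z 0 ω).eta m < (Z 0 ω).xi m} =
      ∫ ω, (if (Z 0 ω).xi m = true then 1 else 0) *
        labelDensity q d (q ^ label (Z 0 ω).xi m) ∂P := by
  classical
  have hmeas := hZ.measurable 0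
  have := Measure.isProbabilityMeasure_map (μ := P) hmeas.aemeasurable
  have hsum : ∀ F : CoupledState d → ℝ, (∃ C, ∀ x, ‖F x‖ ≤ C) → ∫ ω, F (Z 0 ω) ∂P =
      ∑' x : BlockingState, ∑' g : LabelState d, (P.map (Z 0)).real {(x, g)} * F (x, g) := by
    rintro F ⟨C, hC⟩
    have hF := (measurable_of_countable F).aestronglyMeasurable (μ := P.map (Z 0))
    have hint : Integrable F (P.map (Z 0)) := Integrable.of_bound hF C (ae_of_all _ hC)
    rw [← integral_map hmeas.aemeasurable hF, integral_countable hint]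
    have hs : Summable fun x => (P.map (Z 0)).real {x} * F x := by
      have h1 : Summable fun x : CoupledState d => (P.map (Z 0)).real {x} :=
        summable_of_sum_le (fun _ => measureReal_nonneg) fun s =>
          (sum_measureReal_singleton s).trans_le measureReal_le_one
      refine Summable.of_norm_bounded (h1.mul_right C) fun x => ?_
      rw [norm_mul, Real.norm_of_nonneg measureReal_nonneg]
      exact mul_le_mul_of_nonneg_left (hC x) measureReal_nonneg
    simp only [smul_eq_mul]
    exact hs.tsum_prod
  have h1 : P.real {ω | (Z 0 ω).eta m < (Z 0 ω).xi m} =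
      ∫ ω, Set.indicator {x : CoupledState d | x.eta m < x.xi m} 1 (Z 0 ω) ∂P := by
    exact (integral_indicator_one (hmeas (Set.to_countable
      {x : CoupledState d | x.eta m < x.xi m}).measurableSet)).symm
  obtain ⟨C, hC⟩ := exists_labelDensity_bound q d
  rw [h1, hsum (Set.indicator {x | x.eta m < x.xi m} 1)
      ⟨1, fun x => (norm_indicator_le_norm_self _ _).trans (by simp)⟩,
    hsum (fun x => (if x.xi m = true then 1 else 0) * labelDensity q d (q ^ label x.xi m))
      ⟨1 * C, fun x => ?_⟩]
  · refine tsum_congr fun x => ?_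
    obtain ⟨K, hK⟩ := hZ.exists_law_eq hq0 hq1 hstat hξ x
    simp only [hK, Set.indicator_apply, Set.mem_ofPred_eq, CoupledState.eta_lt_xi_iff, Pi.one_apply]
    by_cases hm : x.1 m = true
    · have hl := LabelState.tsum_labels (d := d)
        fun S => if label x.1 m ∈ S then labelWeight q S else 0
      have hl' := LabelState.tsum_labels (d := d) (labelWeight q)
      simp only [← ite_and] at hl
      simp only [hm, true_and, mul_ite, mul_one, mul_zero, CoupledState.xi, if_true, one_mul]
      rw [tsum_mul_right, tsum_mul_left, hl']
      have h2 : ∀ g : LabelState d, (if label x.1 m ∈ g.labels then K * labelWeight q g.labels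
          else 0) = K * if label x.1 m ∈ g.labels then labelWeight q g.labels else 0 :=
        fun g => by split_ifs <;> simp
      simp_rw [h2]
      rw [tsum_mul_left, hl]
      have h3 := labelSumMem_eq hq0 hq1 d (label x.1 m)
      rw [labelSumMem, labelSum] at h3
      rw [h3, mul_assoc]
    · simp [hm, CoupledState.xi]
  · rw [norm_mul]
    refine mul_le_mul ?_ (hC _ (by positivity) (pow_le_one₀ hq0.le hq1.le)) (norm_nonneg _)
      zero_le_one
    split_ifs <;> simp

end

end ASEP

/-! ### The density of second-class particles. -/

theorem theorem1p5 (q : ℝ) (hq0 : 0 < q) (hq1 : q < 1) (c : ℝ) (d : ℕ) (hd : 0 < d)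
    {Ω : Type*} {mΩ : MeasurableSpace Ω} (P : Measure Ω) [IsProbabilityMeasure P]
    (𝓕 : Filtration ℝ≥0 mΩ) (Z : ℝ≥0 → Ω → ASEP.CoupledState d)
    (hZ : ASEP.IsCoupledProcess q d P 𝓕 Z)
    (hstat : ∀ t, P.map (Z t) = P.map (Z 0))
    (hξ : P.map (fun ω => (Z 0 ω).xi) = ASEP.blockingMeasure q c)
    (m : ℤ) (t : ℝ≥0) :
    P.real {ω | (Z t ω).eta m < (Z t ω).xi m} =
      (1 - q ^ d) * q ^ (c - (m : ℝ)) /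
        ((1 + q ^ (c - (m : ℝ))) * (1 + q ^ (c + (d : ℝ) - (m : ℝ)))) := by
  have hmeas := hZ.measurable
  have hS := (Set.to_countable {x : ASEP.CoupledState d | x.eta m < x.xi m}).measurableSet
  have ht : P.real {ω | (Z t ω).eta m < (Z t ω).xi m} =
      P.real {ω | (Z 0 ω).eta m < (Z 0 ω).xi m} := by
    have h := congrArg (fun μ => μ.real {x : ASEP.CoupledState d | x.eta m < x.xi m}) (hstat t)
    simp only [map_measureReal_apply (hmeas _) hS] at h
    exact h
  have hx : 0 < q ^ (c - (m : ℝ)) := Real.rpow_pos_of_pos hq0 _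
  have hxd : q ^ (c + (d : ℝ) - (m : ℝ)) = q ^ (c - (m : ℝ)) * q ^ d := by
    rw [← Real.rpow_natCast q d, ← Real.rpow_add hq0]
    congr 1
    ring
  have hX : Measurable fun ω => if (Z 0 ω).xi m = true then (1 : ℝ) else 0 :=
    (measurable_of_countable fun x : ASEP.CoupledState d =>
      if x.xi m = true then (1 : ℝ) else 0).comp (hmeas 0)
  have hY : Measurable fun ω => q ^ ASEP.label (Z 0 ω).xi m :=
    (measurable_of_countable fun x : ASEP.CoupledState d => q ^ ASEP.label x.xi m).comp (hmeas 0)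
  -- At j = 0 the moment product is the single factor (1 + x)⁻¹ with x = q^(c−m).
  have h := ASEP.integral_labelDensity (P := P) hX hY (fun ω => by split_ifs <;> simp)
    (fun ω => by positivity) (fun ω => pow_le_one₀ hq0.le hq1.le) hq0 hx
    (fun j => ASEP.integral_label_moment hq0 hq1
      ((measurable_of_countable (ASEP.CoupledState.xi (d := d))).comp (hmeas 0))
      (fun ω => (Z 0 ω).1.2) hξ m j) d 0
  simp only [pow_zero, mul_one, zero_add, Finset.range_one, Finset.prod_singleton] at h
  rw [ht, hZ.measureReal_second_class hq0 hq1 hstat hξ m, h, hxd]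
  field_simp
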